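/- Let $k$ be an algebraically closed field of characteristic $0$, and let $H$ be a semisimple Hopf algebra over $k$ with comultiplication $\Delta$ and counit $\varepsilon$. Let $\Lambda\in H$ be the unique two-sided integral with $\varepsilon(\Lambda)=1$, and write $\sum_{(\Lambda)}\Lambda_1\otimes\cdots\otimes\Lambda_m\in H^{\otimes m}$ for the $(m-1)$-fold iterated comultiplication of $\Lambda$. Let $m\ge 1$ be an integer, let $\tau$ be a Hopf algebra automorphism of $H$ with $\tau^m=\mathrm{Id}$, and let $(V,\rho)$ be a finite-dimensional left $H$-module with character $\chi=\operatorname{tr}_V\circ\rho$. Define the $m$-th twisted Frobenius--Schur indicator by $$\nu_m(\chi,\tau)=\sum_{(\Lambda)}\chi\bigl(\Lambda_1\,\tau(\Lambda_2)\cdots\tau^{m-1}(\Lambda_m)\bigr).$$ Let $F_\tau(V)$ be the vector space $V$ with the $H$-action $h\cdot v=\rho(\tau(h))v$, and let $\widetilde{V^{\otimes m}}=V\otimes F_\tau(V)\otimes\cdots\otimes F_\tau^{m-1}(V)$, that is, the vector space $V^{\otimes m}$ with the $H$-action $$h\cdot(v_1\otimes\cdots\otimes v_m)=\sum_{(h)}\rho(h_1)v_1\otimes\rho(\tau(h_2))v_2\otimes\cdots\otimes\rho(\tau^{m-1}(h_m))v_m.$$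 Let $(\widetilde{V^{\otimes m}})^H=\{w : h\cdot w=\varepsilon(h)w \text{ for all } h\in H\}$ be its subspace of invariants, and let $\alpha:V^{\otimes m}\to V^{\otimes m}$ be the linear map with $\alpha(v_1\otimes v_2\otimes\cdots\otimes v_m)=v_2\otimes\cdots\otimes v_m\otimes v_1$. Then $\alpha$ maps $(\widetilde{V^{\otimes m}})^H$ into itself, and $$\nu_m(\chi,\tau)=\operatorname{tr}\Bigl(\alpha\big|_{(\widetilde{V^{\otimes m}})^H}\Bigr).$$ -/

import Mathlib

open scoped TensorProduct

noncomputable section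

namespace TwistedFS

section Integral

variable (k : Type*) {H : Type*} [Field k] [Ring H] [HopfAlgebra k H]

/-- A two-sided integral `Λ` of `H`, normalized by `ε(Λ) = 1`. -/
structure IsNormalizedIntegral (Λ : H) : Prop where
  mul_left : ∀ h : H, h * Λ = (Coalgebra.counit h : k) • Λ
  mul_right : ∀ h : H, Λ * h = (Coalgebra.counit h : k) • Λ
  counit_eq_one : (Coalgebra.counit Λ : k) = 1

theorem IsNormalizedIntegral.unique {Λ Λ' : H} (h : IsNormalizedIntegral k Λ)
    (h' : IsNormalizedIntegral k Λ') : Λ = Λ' := by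
  have h1 := h.mul_right Λ'
  rw [h'.counit_eq_one, one_smul] at h1
  have h2 := h'.mul_left Λ
  rw [h.counit_eq_one, one_smul] at h2
  rw [← h1, h2]

theorem exists_left_integral [IsSemisimpleRing H] :
    ∃ t : H, (∀ h : H, h * t = (Coalgebra.counit h : k) • t) ∧ (Coalgebra.counit t : k) = 1 := by
  let I : Submodule H H := RingHom.ker (Bialgebra.counitAlgHom k H)
  have hI : ∀ x : H, x ∈ I ↔ (Coalgebra.counit x : k) = 0 := fun x => Iff.rfl
  obtain ⟨J, hJ⟩ := exists_isCompl I
  obtain ⟨a, ha, t, ht, hat⟩ := Submodule.mem_sup.1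
    (show (1 : H) ∈ I ⊔ J by rw [hJ.sup_eq_top]; trivial)
  have ht1 : (Coalgebra.counit t : k) = 1 := by
    have := congrArg (Coalgebra.counit (R := k)) hat
    rwa [map_add, (hI a).1 ha, zero_add, Bialgebra.counit_one] at this
  refine ⟨t, fun h => ?_, ht1⟩
  have hmem : h * t - (Coalgebra.counit h : k) • t ∈ I ⊓ J := by
    refine ⟨(hI _).2 ?_, ?_⟩
    · simp [ht1]
    · rw [Algebra.smul_def]
      exact J.sub_mem (J.smul_mem h ht) (J.smul_mem _ ht)
  rw [hJ.inf_eq_bot] at hmem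
  exact sub_eq_zero.1 hmem

theorem exists_right_integral [IsSemisimpleRing H] :
    ∃ t : H, (∀ h : H, t * h = (Coalgebra.counit h : k) • t) ∧ (Coalgebra.counit t : k) = 1 := by
  let ε : Hᵐᵒᵖ →+* k := (Bialgebra.counitAlgHom k H).toRingHom.fromOpposite
    (fun _ _ => mul_comm _ _)
  let I : Submodule Hᵐᵒᵖ Hᵐᵒᵖ := RingHom.ker ε
  have hI : ∀ x : Hᵐᵒᵖ, x ∈ I ↔ (Coalgebra.counit x.unop : k) = 0 := fun x => Iff.rfl
  obtain ⟨J, hJ⟩ := exists_isCompl I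
  obtain ⟨a, ha, t, ht, hat⟩ := Submodule.mem_sup.1
    (show (1 : Hᵐᵒᵖ) ∈ I ⊔ J by rw [hJ.sup_eq_top]; trivial)
  have ht1 : (Coalgebra.counit t.unop : k) = 1 := by
    have := congrArg (fun x => (Coalgebra.counit (R := k) x.unop : k)) hat
    simpa [(hI a).1 ha] using this
  refine ⟨t.unop, fun h => ?_, ht1⟩
  have hmem : MulOpposite.op h * t - (Coalgebra.counit h : k) • t ∈ I ⊓ J := by
    refine ⟨(hI _).2 ?_, ?_⟩
    · simp [ht1]
    · rw [Algebra.smul_def]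
      exact J.sub_mem (J.smul_mem _ ht) (J.smul_mem _ ht)
  rw [hJ.inf_eq_bot] at hmem
  simpa using congrArg MulOpposite.unop (sub_eq_zero.1 hmem)

theorem exists_isNormalizedIntegral [IsSemisimpleRing H] :
    ∃ Λ : H, IsNormalizedIntegral k Λ := by
  obtain ⟨t, ht, ht1⟩ := exists_left_integral k (H := H)
  obtain ⟨s, hs, hs1⟩ := exists_right_integral k (H := H)
  have hst : s = t := by
    have h1 := ht s
    rw [hs1, one_smul] at h1
    have h2 := hs t
    rw [ht1, one_smul] at h2
    rw [← h1, h2]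
  subst hst
  exact ⟨s, ht, hs, ht1⟩

variable (H) in
/-- The unique two-sided integral `Λ` of a semisimple Hopf algebra with `ε(Λ) = 1`. -/
def integral [IsSemisimpleRing H] : H :=
  (exists_isNormalizedIntegral k (H := H)).choose

theorem isNormalizedIntegral_integral [IsSemisimpleRing H] :
    IsNormalizedIntegral k (integral k H) :=
  (exists_isNormalizedIntegral k (H := H)).choose_spec

end Integral

section IterComul

variable (k H : Type*) [Field k] [Ring H] [HopfAlgebra k H]

/-- The linear map `H ⊗ H^{⊗n} → H^{⊗(n+1)}`,
`h ⊗ (h₁ ⊗ ⋯ ⊗ hₙ) ↦ h ⊗ h₁ ⊗ ⋯ ⊗ hₙ`. -/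
def consLinear (n : ℕ) : H ⊗[k] (⨂[k] _ : Fin n, H) →ₗ[k] ⨂[k] _ : Fin (n + 1), H :=
  TensorProduct.lift ((PiTensorProduct.lift (R := k)).toLinearMap ∘ₗ
    (PiTensorProduct.tprod k (s := fun _ : Fin (n + 1) => H)).curryLeft)

theorem consLinear_tmul_tprod (n : ℕ) (h : H) (v : Fin n → H) :
    consLinear k H n (h ⊗ₜ PiTensorProduct.tprod k v) =
      PiTensorProduct.tprod k (Fin.cons h v : Fin (n + 1) → H) := by
  simp [consLinear]

theorem consLinear_mul (n : ℕ) (a b : H) (x y : ⨂[k] _ : Fin n, H) :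
    consLinear k H n ((a * b) ⊗ₜ (x * y)) =
      consLinear k H n (a ⊗ₜ x) * consLinear k H n (b ⊗ₜ y) := by
  induction x using PiTensorProduct.induction_on with
  | add x x' hx hx' => rw [add_mul, TensorProduct.tmul_add, map_add, hx, hx',
      TensorProduct.tmul_add, map_add, add_mul]
  | smul_tprod r v =>
    induction y using PiTensorProduct.induction_on with
    | add x x' hx hx' => rw [mul_add, TensorProduct.tmul_add, map_add, hx, hx',
        TensorProduct.tmul_add, map_add, mul_add]
    | smul_tprod s w =>
      simp only [TensorProduct.tmul_smul, map_smul, consLinear_tmul_tprod,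
        PiTensorProduct.tprod_mul_tprod, smul_mul_assoc, mul_smul_comm]
      congr 3
      funext i
      refine Fin.cases ?_ (fun j => ?_) i <;> simp

/-- `consLinear` as a homomorphism of algebras. -/
def consAlgHom (n : ℕ) : H ⊗[k] (⨂[k] _ : Fin n, H) →ₐ[k] ⨂[k] _ : Fin (n + 1), H :=
  Algebra.TensorProduct.algHomOfLinearMapTensorProduct (consLinear k H n)
    (consLinear_mul k H n)
    (by
      rw [PiTensorProduct.one_def, consLinear_tmul_tprod, PiTensorProduct.one_def]
      congr 1
      funext i
      refine Fin.cases ?_ (fun j => ?_) i <;> simp)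

/-- The iterated comultiplication `Δ^{n-1} : H → H^{⊗n}`, `h ↦ ∑ h₁ ⊗ ⋯ ⊗ hₙ`
(it is the counit for `n = 0` and the identity for `n = 1`). -/
def iterComul : (n : ℕ) → H →ₐ[k] ⨂[k] _ : Fin n, H
  | 0 => (Algebra.ofId k (⨂[k] _ : Fin 0, H)).comp (Bialgebra.counitAlgHom k H)
  | n + 1 => (consAlgHom k H n).comp
      ((Algebra.TensorProduct.map (AlgHom.id k H) (iterComul n)).comp
        (Bialgebra.comulAlgHom k H))

end IterComul

section Representations

variable {k H V : Type*} [Field k] [Ring H] [HopfAlgebra k H] [AddCommGroup V] [Module k V]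

/-- The character of a representation. -/
def character (ρ : H →ₐ[k] Module.End k V) : H →ₗ[k] k :=
  LinearMap.trace k V ∘ₗ ρ.toLinearMap

/-- The twisting functor `F_τ` on objects: `V` with the action `h · v = τ(h) v`. -/
def twist (τ : H →ₐc[k] H) (ρ : H →ₐ[k] Module.End k V) : H →ₐ[k] Module.End k V :=
  ρ.comp (τ : H →ₐ[k] H)

/-- The tensor product `(V, ρ₀) ⊗ ⋯ ⊗ (V, ρₙ₋₁)` of representations on a space `V`: the element `h`
acts by `v₁ ⊗ ⋯ ⊗ vₙ ↦ ∑ ρ₀(h₁) v₁ ⊗ ⋯ ⊗ ρₙ₋₁(hₙ) vₙ`. -/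
def tensorRep {n : ℕ} (ρ : Fin n → H →ₐ[k] Module.End k V) :
    H →ₐ[k] Module.End k (⨂[k] _ : Fin n, V) :=
  (PiTensorProduct.liftAlgHom
    ((PiTensorProduct.mapMultilinear k (fun _ : Fin n => V) (fun _ : Fin n => V)).compLinearMap
      (fun i => (ρ i).toLinearMap))
    (by
      simp only [MultilinearMap.compLinearMap_apply, PiTensorProduct.mapMultilinear_apply,
        Pi.one_apply, AlgHom.toLinearMap_apply, map_one]
      exact PiTensorProduct.map_one)
    (fun x y => by
      simp only [MultilinearMap.compLinearMap_apply, PiTensorProduct.mapMultilinear_apply,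
        Pi.mul_apply, AlgHom.toLinearMap_apply, map_mul]
      exact PiTensorProduct.map_mul _ _)).comp (iterComul k H n)

/-- The twisted tensor power `V ⊗ F_τ(V) ⊗ ⋯ ⊗ F_τ^{m-1}(V)`. -/
def twistedTensorPower (ρ : H →ₐ[k] Module.End k V) (τ : H →ₐc[k] H) (m : ℕ) :
    H →ₐ[k] Module.End k (⨂[k] _ : Fin m, V) :=
  tensorRep fun i : Fin m => (twist τ)^[i] ρ

/-- The subspace of `H`-invariants of a representation: `h · v = ε(h) v` for all `h`. -/
def invariants (ρ : H →ₐ[k] Module.End k V) : Submodule k V where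
  carrier := {v | ∀ h : H, ρ h v = (Coalgebra.counit h : k) • v}
  add_mem' hv hw h := by rw [map_add, hv h, hw h, smul_add]
  zero_mem' h := by simp
  smul_mem' c v hv h := by rw [map_smul, hv h, smul_comm]

variable (k V) in
/-- The cyclic shift `v₁ ⊗ v₂ ⊗ ⋯ ⊗ vₘ ↦ v₂ ⊗ ⋯ ⊗ vₘ ⊗ v₁`. -/
def cyclicShift (m : ℕ) : Module.End k (⨂[k] _ : Fin m, V) :=
  (PiTensorProduct.reindex k (fun _ : Fin m => V) (finRotate m).symm).toLinearMap

/-- The `m`-th twisted Frobenius-Schur indicator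
`ν_m(χ, τ) = ∑ χ(Λ₁ τ(Λ₂) ⋯ τ^{m-1}(Λₘ))`. -/
def twistedIndicator [IsSemisimpleRing H] (m : ℕ) (χ : H →ₗ[k] k) (τ : H →ₐc[k] H) : k :=
  χ (PiTensorProduct.lift
    ((MultilinearMap.mkPiAlgebraFin k m H).compLinearMap
      (fun i : Fin m => ((τ ^ (i : ℕ) : H →ₐc[k] H) : H →ₐ[k] H).toLinearMap))
    (iterComul k H m (integral k H)))

end Representations

end TwistedFS

end

/-!
The normalized integral `Λ` acts on every representation as the projection to the invariants.
Hence the trace of the cyclic shift `α` on the invariants, once they are known to be stable, is the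
trace of `α ∘ Λ` on the whole twisted tensor power, and the identity
`tr(α ∘ (f₁ ⊗ ⋯ ⊗ fₘ)) = tr(f₁ ⋯ fₘ)` (`trace_cyclicShift_mul_map`) turns it into the indicator.

The substance of the theorem is that `α` preserves the invariants. Since `τᵐ = 1`, the shift
intertwines the action of `τ(h₁) ⊗ ⋯ ⊗ τ(hₘ)` with that of `hₘ ⊗ h₁ ⊗ ⋯ ⊗ hₘ₋₁`, so one needs
`∑ h₂ ⊗ h₁` to act on an invariant `w` of a tensor product of two representations through
`ε(h)`. As `(1 ⊗ h) w = (S(h) ⊗ 1) w`, it acts through `∑ h₂ S(h₁) ⊗ 1`, and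
`∑ h₂ S(h₁) = ε(h)` if `S² = 1` (`apply_comm_comul_of_antipode_antipode`). That `S² = 1` for
semisimple Hopf algebras in characteristic zero is the theorem of Larson and Radford
(`IsNormalizedIntegral.antipode_antipode`), which is proved here as follows.

* The elements `∑ f(Λ₁) Λ₂` form a left ideal containing `∑ S(Λ₁) Λ₂ = 1`. So `H` is finite
  dimensional, there is a functional `l` with `∑ l(Λ₁) Λ₂ = 1`, and `l` is an integral of the dual
  and a nondegenerate form with Nakayama automorphism `S²`. Comparing `l` with `l ∘ S` gives
  `S⁴(h) = g h g⁻¹` for the group-like element `g = ∑ Λ₁ l(Λ₂)`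
  (`IsNormalizedIntegral.mul_eq_antipode_pow_four_mul`); since `g` has finite order, so has `S²`.
* The form `l` yields the trace formula `tr(S² ∘ (h ↦ ∑ h₁ f(h₂))) = f(Λ) l(1)`. In particular
  `tr(S²) = l(1)`. On the matrix blocks of `H`, `S²` is conjugation by matrices `bᵢ` with a scalar
  power, so `tr(S²) = ∑ tr(bᵢ) tr(bᵢ⁻¹)` is, after rescaling the `bᵢ`, a sum of squares of absolute
  values in a cyclotomic field. The block of `Λ` contributes a nonzero term, hence `l(1) ≠ 0`
  (`IsNormalizedIntegral.apply_one_ne_zero`), and then `l ∘ S = l` and `S⁴ = 1`.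
* For the character `χ` of the regular representation, `n = dim H`, the map
  `h ↦ n⁻¹ ∑ h₁ χ(h₂)` is idempotent and commutes with `S²`, and the trace formula says that `n`
  times the trace of its composition with `S²` is `l(1) = tr(S²)` as well. Both traces are integers
  because `S⁴ = 1`. So `n` divides the nonzero integer `tr(S²)`, all eigenvalues of `S²` agree,
  and `S²(1) = 1` leaves only `S² = 1`.
-/

noncomputable section

namespace TwistedFS

open Coalgebra HopfAlgebra WithConv

/-! ### Sweedler calculus in a Hopf algebra -/

section Sweedler

variable {k H : Type*} [Field k] [Ring H] [HopfAlgebra k H]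

variable (k H) in
/-- `h ↦ h ⊗ 1`. -/
abbrev inclLeft : H →ₐ[k] H ⊗[k] H := Algebra.TensorProduct.includeLeft

variable (k H) in
/-- `h ↦ 1 ⊗ h`. -/
abbrev inclRight : H →ₐ[k] H ⊗[k] H := Algebra.TensorProduct.includeRight

/-- In the convolution algebra `Hom(H, H ⊗ H)` the comultiplication factors through the two
inclusions, which have convolution inverses obtained from the antipode. -/
theorem toConv_comul :
    toConv (comul (R := k) (A := H)) =
      toConv (inclLeft k H).toLinearMap * toConv (inclRight k H).toLinearMap := by
  ext h
  rw [(ℛ k h).convMul_apply]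
  simp [(ℛ k h).eq]

theorem toConv_comp_antipode_mul {A : Type*} [Ring A] [Algebra k A] (φ : H →ₐ[k] A) :
    toConv (φ.toLinearMap ∘ₗ antipode k) * toConv φ.toLinearMap = 1 := by
  ext h
  rw [(ℛ k h).convMul_apply]
  simp [← map_mul, ← map_sum, sum_antipode_mul_eq_algebraMap_counit]

theorem toConv_mul_comp_antipode {A : Type*} [Ring A] [Algebra k A] (φ : H →ₐ[k] A) :
    toConv φ.toLinearMap * toConv (φ.toLinearMap ∘ₗ antipode k) = 1 := by
  ext h
  rw [(ℛ k h).convMul_apply]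
  simp [← map_mul, ← map_sum, sum_mul_antipode_eq_algebraMap_counit]

theorem sum_antipode_tmul_one_mul_comul {ι : Type*} {h : H} (r : Coalgebra.Repr k h ι) :
    ∑ i ∈ r.index, (antipode k (r.left i) ⊗ₜ[k] (1 : H)) * comul (r.right i) = 1 ⊗ₜ h := by
  have := congrArg (toConv ((inclLeft k H).toLinearMap ∘ₗ antipode k) * ·)
    (toConv_comul (k := k) (H := H))
  simp only [← mul_assoc, toConv_comp_antipode_mul, one_mul] at this
  have := congrArg (fun f => f h) this
  simp only [r.convMul_apply] at this
  simpa using this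

theorem sum_comul_mul_one_tmul_antipode {ι : Type*} {h : H} (r : Coalgebra.Repr k h ι) :
    ∑ i ∈ r.index, comul (r.left i) * ((1 : H) ⊗ₜ[k] antipode k (r.right i)) = h ⊗ₜ 1 := by
  have := congrArg (· * toConv ((inclRight k H).toLinearMap ∘ₗ antipode k))
    (toConv_comul (k := k) (H := H))
  simp only [mul_assoc, toConv_mul_comp_antipode, mul_one] at this
  have := congrArg (fun f => f h) this
  simp only [r.convMul_apply] at this
  simpa using this

/-- The antipode reverses the comultiplication: both sides of the identity are convolution
inverse to the comultiplication in `Hom(H, H ⊗ H)`. -/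
theorem comul_antipode (h : H) :
    comul (antipode k h) = TensorProduct.map (antipode k) (antipode k)
      (TensorProduct.comm k H H (comul (R := k) h)) := by
  have hinv : (toConv ((inclRight k H).toLinearMap ∘ₗ antipode k) *
      toConv ((inclLeft k H).toLinearMap ∘ₗ antipode k)) *
      toConv (comul (R := k) (A := H)) = 1 := by
    rw [toConv_comul, mul_assoc, ← mul_assoc _ (toConv (inclLeft k H).toLinearMap),
      toConv_comp_antipode_mul, one_mul, toConv_comp_antipode_mul]
  have := congrArg (fun f => f h) (left_inv_eq_right_inv hinv LinearMap.comul_right_inv)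
  simp only [(ℛ k h).convMul_apply] at this
  rw [← (ℛ k h).eq]
  simpa using this.symm

theorem comul_antipode_antipode (h : H) :
    comul (antipode k (antipode k h)) =
      TensorProduct.map (antipode k ∘ₗ antipode k) (antipode k ∘ₗ antipode k)
        (comul (R := k) h) := by
  rw [comul_antipode, comul_antipode, ← (ℛ k h).eq]
  simp

/-- Left contraction `h ↦ ∑ f(h₁) h₂` of the comultiplication with a functional. -/
def contractLeft (f : H →ₗ[k] k) : H →ₗ[k] H :=
  (TensorProduct.lid k H).toLinearMap ∘ₗ f.rTensor H ∘ₗ comul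

/-- Right contraction `h ↦ ∑ h₁ f(h₂)` of the comultiplication with a functional. -/
def contractRight (f : H →ₗ[k] k) : H →ₗ[k] H :=
  (TensorProduct.rid k H).toLinearMap ∘ₗ f.lTensor H ∘ₗ comul

theorem contractLeft_apply (f : H →ₗ[k] k) (h : H) :
    contractLeft f h = TensorProduct.lid k H (f.rTensor H (comul h)) := rfl

theorem contractRight_apply (f : H →ₗ[k] k) (h : H) :
    contractRight f h = TensorProduct.rid k H (f.lTensor H (comul h)) := rfl

theorem contractLeft_eq_sum {ι : Type*} (f : H →ₗ[k] k) {h : H} (r : Coalgebra.Repr k h ι) :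
    contractLeft f h = ∑ i ∈ r.index, f (r.left i) • r.right i := by
  simp [contractLeft, ← r.eq]

theorem contractRight_eq_sum {ι : Type*} (f : H →ₗ[k] k) {h : H} (r : Coalgebra.Repr k h ι) :
    contractRight f h = ∑ i ∈ r.index, f (r.right i) • r.left i := by
  simp [contractRight, ← r.eq]

theorem comul_contractLeft (f : H →ₗ[k] k) (h : H) :
    comul (contractLeft f h) = (contractLeft f).rTensor H (comul (R := k) h) := by
  have key := congrArg ((TensorProduct.lid k (H ⊗[k] H)).toLinearMap ∘ₗ f.rTensor (H ⊗[k] H))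
    (coassoc_apply (R := k) h)
  have h1 : ∀ x : H ⊗[k] H, (TensorProduct.lid k (H ⊗[k] H)) (f.rTensor (H ⊗[k] H)
      (TensorProduct.assoc k H H H (comul.rTensor H x))) = (contractLeft f).rTensor H x := by
    intro x
    induction x using TensorProduct.induction_on with
    | zero => simp
    | add x y hx hy => simp only [map_add, hx, hy]
    | tmul a b =>
      rw [LinearMap.rTensor_tmul, LinearMap.rTensor_tmul, contractLeft_eq_sum f (ℛ k a),
        ← (ℛ k a).eq]
      simp [TensorProduct.sum_tmul, TensorProduct.smul_tmul']
  have h2 : ∀ x : H ⊗[k] H, (TensorProduct.lid k (H ⊗[k] H)) (f.rTensor (H ⊗[k] H)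
      (comul.lTensor H x)) = comul (TensorProduct.lid k H (f.rTensor H x)) := by
    intro x
    induction x using TensorProduct.induction_on with
    | zero => simp
    | add x y hx hy => simp only [map_add, hx, hy]
    | tmul a b => simp
  simp only [LinearMap.comp_apply, LinearEquiv.coe_coe] at key
  rw [h1, h2] at key
  exact key.symm

theorem comul_contractRight (f : H →ₗ[k] k) (h : H) :
    comul (contractRight f h) = (contractRight f).lTensor H (comul (R := k) h) := by
  have key := congrArg ((TensorProduct.rid k (H ⊗[k] H)).toLinearMap ∘ₗ f.lTensor (H ⊗[k] H))
    (coassoc_symm_apply (R := k) h)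
  have h1 : ∀ x : H ⊗[k] H, (TensorProduct.rid k (H ⊗[k] H)) (f.lTensor (H ⊗[k] H)
      ((TensorProduct.assoc k H H H).symm (comul.lTensor H x))) =
        (contractRight f).lTensor H x := by
    intro x
    induction x using TensorProduct.induction_on with
    | zero => simp
    | add x y hx hy => simp only [map_add, hx, hy]
    | tmul a b =>
      rw [LinearMap.lTensor_tmul, LinearMap.lTensor_tmul, contractRight_eq_sum f (ℛ k b),
        ← (ℛ k b).eq]
      simp [TensorProduct.tmul_sum]
  have h2 : ∀ x : H ⊗[k] H, (TensorProduct.rid k (H ⊗[k] H)) (f.lTensor (H ⊗[k] H)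
      (comul.rTensor H x)) = comul (TensorProduct.rid k H (f.lTensor H x)) := by
    intro x
    induction x using TensorProduct.induction_on with
    | zero => simp
    | add x y hx hy => simp only [map_add, hx, hy]
    | tmul a b => simp
  simp only [LinearMap.comp_apply, LinearEquiv.coe_coe] at key
  rw [h1, h2] at key
  exact key.symm

theorem contractRight_contractRight (f g : H →ₗ[k] k) (h : H) :
    contractRight f (contractRight g h) = contractRight (f ∘ₗ contractRight g) h := by
  rw [contractRight_apply f, comul_contractRight, contractRight_eq_sum _ (ℛ k h)]
  conv_lhs => rw [← (ℛ k h).eq]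
  simp

theorem contractLeft_contractLeft (f g : H →ₗ[k] k) (h : H) :
    contractLeft f (contractLeft g h) = contractLeft (f ∘ₗ contractLeft g) h := by
  rw [contractLeft_apply f, comul_contractLeft, contractLeft_eq_sum _ (ℛ k h)]
  conv_lhs => rw [← (ℛ k h).eq]
  simp

/-- Both contractions give the convolution product `∑ f(h₁) g(h₂)` of functionals. -/
theorem apply_contractLeft (f g : H →ₗ[k] k) (h : H) :
    g (contractLeft f h) = f (contractRight g h) := by
  rw [contractLeft_eq_sum f (ℛ k h), contractRight_eq_sum g (ℛ k h)]
  simp [mul_comm]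

theorem contractLeft_counit (h : H) : contractLeft (counit (R := k)) h = h := by
  simp [contractLeft]

theorem contractRight_counit (h : H) : contractRight (counit (R := k)) h = h := by
  simp [contractRight]

theorem counit_contractLeft (f : H →ₗ[k] k) (h : H) :
    (counit (contractLeft f h) : k) = f h := by
  rw [apply_contractLeft, contractRight_counit]

theorem counit_contractRight (f : H →ₗ[k] k) (h : H) :
    (counit (contractRight f h) : k) = f h := by
  rw [← apply_contractLeft, contractLeft_counit]

end Sweedler

/-! ### Integrals and the Frobenius form -/

section Frobenius

variable {k H : Type*} [Field k] [Ring H] [HopfAlgebra k H]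

/-- On an invariant `w` of a tensor product of two representations, `1 ⊗ h` acts as `S(h) ⊗ 1`,
because `1 ⊗ h = ∑ (S(h₁) ⊗ 1) Δ(h₂)`. -/
theorem apply_one_tmul_eq_apply_antipode_tmul {M : Type*} [AddCommGroup M] [Module k M]
    (C : H ⊗[k] H →ₐ[k] Module.End k M) {w : M}
    (hw : ∀ h : H, C (comul h) w = (counit h : k) • w) (h : H) :
    C (1 ⊗ₜ h) w = C (antipode k h ⊗ₜ 1) w := by
  rw [← sum_antipode_tmul_one_mul_comul (ℛ k h), map_sum, LinearMap.sum_apply]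
  simp only [map_mul, Module.End.mul_apply, hw, map_smul]
  have h1 := congrArg (antipode k) (contractRight_counit (k := k) h)
  rw [contractRight_eq_sum _ (ℛ k h)] at h1
  conv_rhs => rw [← h1]
  simp [TensorProduct.sum_tmul, ← TensorProduct.smul_tmul']

namespace IsNormalizedIntegral

variable {Λ : H}

theorem one_tmul_mul_comul (hΛ : IsNormalizedIntegral k Λ) (h : H) :
    ((1 : H) ⊗ₜ[k] h) * comul Λ = (antipode k h ⊗ₜ 1) * comul Λ :=
  apply_one_tmul_eq_apply_antipode_tmul (Algebra.lmul k (H ⊗[k] H)) (w := comul Λ)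
    (fun h => by simp [← Bialgebra.comul_mul, hΛ.mul_left]) h

theorem comul_mul_tmul_one (hΛ : IsNormalizedIntegral k Λ) (h : H) :
    comul Λ * (h ⊗ₜ[k] (1 : H)) = comul Λ * (1 ⊗ₜ antipode k h) := by
  rw [← sum_comul_mul_one_tmul_antipode (ℛ k h), Finset.mul_sum]
  simp only [← mul_assoc, ← Bialgebra.comul_mul, hΛ.mul_right, map_smul]
  have h1 := congrArg (antipode k) (contractLeft_counit (k := k) h)
  rw [contractLeft_eq_sum _ (ℛ k h)] at h1
  conv_rhs => rw [← h1]
  simp [TensorProduct.tmul_sum, Finset.mul_sum]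

theorem contractLeft_mulLeft_antipode (hΛ : IsNormalizedIntegral k Λ) (f : H →ₗ[k] k) (h : H) :
    contractLeft (f ∘ₗ LinearMap.mulLeft k (antipode k h)) Λ = h * contractLeft f Λ := by
  have := congrArg ((TensorProduct.lid k H).toLinearMap ∘ₗ f.rTensor H) (hΛ.one_tmul_mul_comul h)
  rw [contractLeft_eq_sum _ (ℛ k Λ), contractLeft_eq_sum _ (ℛ k Λ)]
  rw [← (ℛ k Λ).eq] at this
  simpa [Finset.mul_sum] using this.symm

theorem contractLeft_mulRight (hΛ : IsNormalizedIntegral k Λ) (f : H →ₗ[k] k) (h : H) :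
    contractLeft (f ∘ₗ LinearMap.mulRight k h) Λ = contractLeft f Λ * antipode k h := by
  have := congrArg ((TensorProduct.lid k H).toLinearMap ∘ₗ f.rTensor H) (hΛ.comul_mul_tmul_one h)
  rw [contractLeft_eq_sum _ (ℛ k Λ), contractLeft_eq_sum _ (ℛ k Λ)]
  rw [← (ℛ k Λ).eq] at this
  simpa [Finset.sum_mul] using this

/-- The functionals `f` with `∑ f(Λ₁) Λ₂ = h` exist for `h = 1`: the elements `∑ f(Λ₁) Λ₂` form
a left ideal, which contains `∑ S(Λ₁) Λ₂ = ε(Λ) = 1`. -/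
theorem exists_contractLeft_eq_one (hΛ : IsNormalizedIntegral k Λ) :
    ∃ l : H →ₗ[k] k, contractLeft l Λ = 1 := by
  let e := Module.Basis.ofVectorSpace k H
  obtain ⟨b, hb⟩ := TensorProduct.eq_repr_basis_left e (comul (R := k) Λ)
  let r : Coalgebra.Repr k Λ _ := ⟨b.support, e, b, hb⟩
  have hr : ∀ i ∈ r.index, contractLeft (e.coord i) Λ = b i := by
    intro i hi
    rw [contractLeft_eq_sum _ r, Finset.sum_eq_single i]
    · simp [r]
    · intro j _ hj
      simp [r, hj]
    · exact fun h => absurd hi h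
  -- The left tensor factors are basis vectors, so each right factor `b i` is `∑ eᵢ*(Λ₁) Λ₂`, and
  -- `1 = ∑ S(eᵢ) b i`.
  refine ⟨∑ i ∈ r.index, e.coord i ∘ₗ LinearMap.mulLeft k (antipode k (antipode k (e i))), ?_⟩
  have h1 := sum_antipode_mul_eq_smul r
  rw [hΛ.counit_eq_one, one_smul] at h1
  rw [← h1, contractLeft_eq_sum _ r]
  simp only [LinearMap.sum_apply, Finset.sum_smul]
  rw [Finset.sum_comm]
  refine Finset.sum_congr rfl fun i hi => ?_
  rw [← contractLeft_eq_sum _ r, hΛ.contractLeft_mulLeft_antipode, hr i hi]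

theorem contractLeft_mulLeft_antipode_of_eq_one (hΛ : IsNormalizedIntegral k Λ)
    {l : H →ₗ[k] k} (hl : contractLeft l Λ = 1) (h : H) :
    contractLeft (l ∘ₗ LinearMap.mulLeft k (antipode k h)) Λ = h := by
  rw [hΛ.contractLeft_mulLeft_antipode, hl, mul_one]

/-- A Hopf algebra with a normalized integral is finite dimensional: it is spanned by the right
tensor factors of `Δ(Λ)`, since `h = ∑ l(S(h) Λ₁) Λ₂`. -/
theorem finiteDimensional (hΛ : IsNormalizedIntegral k Λ) : FiniteDimensional k H := by
  classical
  obtain ⟨l, hl⟩ := hΛ.exists_contractLeft_eq_one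
  refine ⟨⟨(ℛ k Λ).index.image (ℛ k Λ).right, ?_⟩⟩
  rw [eq_top_iff]
  intro h _
  rw [← hΛ.contractLeft_mulLeft_antipode_of_eq_one hl h, contractLeft_eq_sum _ (ℛ k Λ)]
  exact Submodule.sum_mem _ fun i hi => Submodule.smul_mem _ _
    (Submodule.subset_span (by simpa using ⟨_, _, hi, rfl⟩))

theorem contractLeft_injective (hΛ : IsNormalizedIntegral k Λ) {f f' : H →ₗ[k] k}
    (h : contractLeft f Λ = contractLeft f' Λ) : f = f' := by
  obtain ⟨l, hl⟩ := hΛ.exists_contractLeft_eq_one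
  have := hΛ.finiteDimensional
  let β : Module.Dual k H →ₗ[k] H :=
    { toFun := fun f => contractLeft f Λ
      map_add' := fun f g => by
        simp [contractLeft_eq_sum _ (ℛ k Λ), add_smul, Finset.sum_add_distrib]
      map_smul' := fun c g => by simp [contractLeft_eq_sum _ (ℛ k Λ), mul_smul, Finset.smul_sum] }
  have hβ : Function.Surjective β :=
    fun h => ⟨_, hΛ.contractLeft_mulLeft_antipode_of_eq_one hl h⟩
  exact (LinearMap.injective_iff_surjective_of_finrank_eq_finrank Subspace.dual_finrank_eq).2 hβ h

theorem antipode_injective (hΛ : IsNormalizedIntegral k Λ) :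
    Function.Injective (antipode k (A := H)) := by
  obtain ⟨l, hl⟩ := hΛ.exists_contractLeft_eq_one
  intro x y hxy
  rw [← hΛ.contractLeft_mulLeft_antipode_of_eq_one hl x, hxy,
    hΛ.contractLeft_mulLeft_antipode_of_eq_one hl y]

theorem antipode_surjective (hΛ : IsNormalizedIntegral k Λ) :
    Function.Surjective (antipode k (A := H)) := by
  have := hΛ.finiteDimensional
  exact LinearMap.injective_iff_surjective.1 hΛ.antipode_injective

theorem antipode_eq (hΛ : IsNormalizedIntegral k Λ) : antipode k Λ = Λ := by
  obtain ⟨h, hh⟩ := hΛ.antipode_surjective Λ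
  have h1 : (counit h : k) = 1 := by
    rw [← counit_antipode, hh, hΛ.counit_eq_one]
  have h2 : antipode k Λ * Λ = antipode k Λ := by
    conv_lhs => rw [← hh, ← antipode_mul_antidistrib, hh, hΛ.mul_left, h1, one_smul]
  rw [← h2, hΛ.mul_left, counit_antipode, hΛ.counit_eq_one, one_smul]

end IsNormalizedIntegral

theorem antipode_contractRight (f : H →ₗ[k] k) (h : H) :
    antipode k (contractRight (f ∘ₗ antipode k) h) = contractLeft f (antipode k h) := by
  rw [contractRight_eq_sum _ (ℛ k h), contractLeft_apply, comul_antipode, ← (ℛ k h).eq]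
  simp

namespace IsNormalizedIntegral

variable {Λ : H} {l : H →ₗ[k] k}

/-- A functional `l` with `∑ l(Λ₁) Λ₂ = 1` is an integral of the dual Hopf algebra. -/
theorem contractLeft_eq_smul_one (hΛ : IsNormalizedIntegral k Λ) (hl : contractLeft l Λ = 1)
    (h : H) : contractLeft l h = l h • 1 := by
  rw [← sub_eq_zero, ← Module.forall_dual_apply_eq_zero_iff k]
  intro f
  have : f ∘ₗ contractLeft l = f 1 • l := by
    refine hΛ.contractLeft_injective ?_
    rw [← contractLeft_contractLeft, hl, contractLeft_apply, Bialgebra.comul_one,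
      contractLeft_eq_sum _ (ℛ k Λ)]
    simp only [LinearMap.smul_apply, smul_assoc]
    rw [← Finset.smul_sum, ← contractLeft_eq_sum _ (ℛ k Λ), hl]
    simp [Algebra.TensorProduct.one_def]
  rw [map_sub, sub_eq_zero]
  have := LinearMap.congr_fun this h
  simpa [mul_comm] using this

/-- Integrals of the dual Hopf algebra are unique up to a scalar. -/
theorem eq_smul_of_contractLeft (hΛ : IsNormalizedIntegral k Λ) (hl : contractLeft l Λ = 1)
    {f : H →ₗ[k] k} (hf : ∀ h, contractLeft f h = f h • 1) : f = f Λ • l := by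
  refine hΛ.contractLeft_injective ?_
  rw [hf, contractLeft_eq_sum _ (ℛ k Λ)]
  simp only [LinearMap.smul_apply, smul_assoc]
  rw [← Finset.smul_sum, ← contractLeft_eq_sum _ (ℛ k Λ), hl]

theorem contractRight_comp_antipode (hΛ : IsNormalizedIntegral k Λ) {f : H →ₗ[k] k}
    (hf : ∀ h, contractLeft f h = f h • 1) (h : H) :
    contractRight (f ∘ₗ antipode k) h = f (antipode k h) • 1 := by
  apply hΛ.antipode_injective
  rw [antipode_contractRight, hf, map_smul, antipode_one]

theorem contractLeft_of_comp_antipode (hΛ : IsNormalizedIntegral k Λ) {f : H →ₗ[k] k}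
    (hf : ∀ h, contractRight (f ∘ₗ antipode k) h = f (antipode k h) • 1) (h : H) :
    contractLeft f h = f h • 1 := by
  obtain ⟨h, rfl⟩ := hΛ.antipode_surjective h
  rw [← antipode_contractRight, hf, map_smul, antipode_one]

/-- The functional `x ↦ l(x y)` is `x ↦ l(S²(y) x)`: the Nakayama automorphism of the Frobenius
form `l` is the square of the antipode. -/
theorem apply_mul (hΛ : IsNormalizedIntegral k Λ) (hl : contractLeft l Λ = 1) (x y : H) :
    l (x * y) = l (antipode k (antipode k y) * x) := by
  have : l ∘ₗ LinearMap.mulRight k y = l ∘ₗ LinearMap.mulLeft k (antipode k (antipode k y)) := by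
    refine hΛ.contractLeft_injective ?_
    rw [hΛ.contractLeft_mulRight, hΛ.contractLeft_mulLeft_antipode, hl, one_mul, mul_one]
  exact LinearMap.congr_fun this x

/-- The form `(x, y) ↦ l(x y)` is nondegenerate. -/
theorem eq_of_forall_apply_mul (hΛ : IsNormalizedIntegral k Λ) (hl : contractLeft l Λ = 1)
    {x y : H} (h : ∀ z, l (x * z) = l (y * z)) : x = y := by
  obtain ⟨x, rfl⟩ := hΛ.antipode_surjective x
  obtain ⟨y, rfl⟩ := hΛ.antipode_surjective y
  congr 1
  rw [← hΛ.contractLeft_mulLeft_antipode_of_eq_one hl x,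
    ← hΛ.contractLeft_mulLeft_antipode_of_eq_one hl y]
  exact congrArg (contractLeft · Λ) (LinearMap.ext h)

/-- For every functional `f`, the functional `∑ f(h₁) l(h₂)` is again an integral of the dual, hence
a multiple of `l`. -/
theorem contractRight_eq_smul (hΛ : IsNormalizedIntegral k Λ) (hl : contractLeft l Λ = 1)
    (h : H) : contractRight l h = l h • contractRight l Λ := by
  rw [← sub_eq_zero, ← Module.forall_dual_apply_eq_zero_iff k]
  intro f
  have h1 := hΛ.eq_smul_of_contractLeft hl (f := l ∘ₗ contractLeft f) fun h => by
    rw [← contractLeft_contractLeft, hΛ.contractLeft_eq_smul_one hl, LinearMap.comp_apply]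
  have := LinearMap.congr_fun h1 h
  simp only [LinearMap.comp_apply, LinearMap.smul_apply, apply_contractLeft, smul_eq_mul] at this
  rw [map_sub, map_smul, ← apply_contractLeft, ← apply_contractLeft] 
  simp [this, mul_comm, apply_contractLeft]

/-- The distinguished element `∑ Λ₁ l(Λ₂)` is group-like. -/
theorem isGroupLikeElem (hΛ : IsNormalizedIntegral k Λ) (hl : contractLeft l Λ = 1) :
    IsGroupLikeElem k (contractRight l Λ) where
  counit_eq_one := by
    rw [counit_contractRight, ← counit_contractLeft, hl, Bialgebra.counit_one]
  comul_eq_tmul_self := by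
    conv_rhs => enter [2]; rw [contractRight_eq_sum _ (ℛ k Λ)]
    rw [comul_contractRight]
    conv_lhs => rw [← (ℛ k Λ).eq]
    simp only [map_sum, LinearMap.lTensor_tmul, TensorProduct.sum_tmul]
    refine Finset.sum_congr rfl fun i _ => ?_
    rw [hΛ.contractRight_eq_smul hl, TensorProduct.tmul_smul, TensorProduct.smul_tmul']

theorem contractRight_mulLeft_of_isGroupLikeElem (f : H →ₗ[k] k) {g : H}
    (hg : IsGroupLikeElem k g) (h : H) :
    g * contractRight (f ∘ₗ LinearMap.mulLeft k g) h = contractRight f (g * h) := by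
  rw [contractRight_eq_sum _ (ℛ k h), contractRight_apply, Bialgebra.comul_mul,
    hg.comul_eq_tmul_self, ← (ℛ k h).eq]
  simp [Finset.mul_sum]

/-- The functional `l ∘ S` is the translate of `l` by the distinguished group-like element. -/
theorem apply_antipode (hΛ : IsNormalizedIntegral k Λ) (hl : contractLeft l Λ = 1) (h : H) :
    l (antipode k h) = l (contractRight l Λ * h) := by
  set g := contractRight l Λ with hgdef
  have hg := hΛ.isGroupLikeElem hl
  rw [← hgdef] at hg
  have hlΛ : l Λ = 1 := by rw [← counit_contractLeft, hl, Bialgebra.counit_one]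
  have h1 : ∀ h, contractRight (l ∘ₗ LinearMap.mulLeft k g) h = l (g * h) • 1 := fun h => by
    apply hg.isUnit.mul_left_cancel
    rw [contractRight_mulLeft_of_isGroupLikeElem _ hg, hΛ.contractRight_eq_smul hl, ← hgdef]
    simp
  let S : H ≃ₗ[k] H := LinearEquiv.ofBijective (antipode k)
    ⟨hΛ.antipode_injective, hΛ.antipode_surjective⟩
  have hS : ∀ h, S.symm (antipode k h) = h := S.symm_apply_apply
  let f : H →ₗ[k] k := (l ∘ₗ LinearMap.mulLeft k g) ∘ₗ S.symm.toLinearMap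
  have hf : f ∘ₗ antipode k = l ∘ₗ LinearMap.mulLeft k g := by
    ext h
    simp [f, hS]
  have h2 := hΛ.eq_smul_of_contractLeft hl (f := f) (hΛ.contractLeft_of_comp_antipode fun h => by
    rw [hf, h1, ← LinearMap.comp_apply f, hf]
    rfl)
  have h3 : f Λ = 1 := by
    conv_lhs => rw [← hΛ.antipode_eq, ← LinearMap.comp_apply, hf]
    simp [hΛ.mul_left, hg.counit_eq_one, hlΛ]
  rw [h3, one_smul] at h2
  have := LinearMap.congr_fun hf h
  rwa [h2] at this

/-- **Radford's formula** for the fourth power of the antipode of a semisimple Hopf algebra. -/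
theorem mul_eq_antipode_pow_four_mul (hΛ : IsNormalizedIntegral k Λ) (hl : contractLeft l Λ = 1)
    (y : H) : contractRight l Λ * y =
      antipode k (antipode k (antipode k (antipode k y))) * contractRight l Λ := by
  refine hΛ.eq_of_forall_apply_mul hl fun x => ?_
  rw [mul_assoc, ← hΛ.apply_antipode hl, antipode_mul_antidistrib, hΛ.apply_mul hl,
    ← antipode_mul_antidistrib, hΛ.apply_antipode hl, ← mul_assoc, hΛ.apply_mul hl, mul_assoc]

/-- If `l(1) ≠ 0`, that is, if the dual Hopf algebra is semisimple as well, then `S⁴ = 1`. -/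
theorem antipode_pow_four_eq (hΛ : IsNormalizedIntegral k Λ) (hl : contractLeft l Λ = 1)
    (h1 : l 1 ≠ 0) (y : H) : antipode k (antipode k (antipode k (antipode k y))) = y := by
  have hμ : ∀ h, l (antipode k h) = l h := fun h => by
    have := apply_contractLeft l (l ∘ₗ antipode k) h
    rw [hΛ.contractLeft_eq_smul_one hl,
      hΛ.contractRight_comp_antipode (hΛ.contractLeft_eq_smul_one hl)] at this
    simp only [map_smul, LinearMap.comp_apply, antipode_one, smul_eq_mul] at this
    exact (mul_right_cancel₀ h1 this).symm
  refine hΛ.eq_of_forall_apply_mul hl fun x => ?_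
  rw [← hΛ.apply_mul hl, ← hμ, antipode_mul_antidistrib, ← hΛ.apply_mul hl,
    ← antipode_mul_antidistrib, hμ]

/-- The trace formula `tr F = ∑ l(S(F(Λ₂)) Λ₁)` for an endomorphism `F` of `H`. -/
theorem trace_eq_sum (hΛ : IsNormalizedIntegral k Λ) (hl : contractLeft l Λ = 1)
    (F : Module.End k H) {ι : Type*} (r : Coalgebra.Repr k Λ ι) :
    LinearMap.trace k H F = ∑ i ∈ r.index, l (antipode k (F (r.right i)) * r.left i) := by
  have := hΛ.finiteDimensional
  have hF : F = ∑ i ∈ r.index,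
      (l ∘ₗ LinearMap.mulRight k (r.left i) ∘ₗ antipode k).smulRight (F (r.right i)) := by
    ext x
    conv_lhs => rw [← hΛ.contractLeft_mulLeft_antipode_of_eq_one hl x, contractLeft_eq_sum _ r]
    simp
  conv_lhs => rw [hF]
  simp [LinearMap.trace_smulRight]

/-- The trace of `S² ∘ (h ↦ ∑ h₁ f(h₂))` is `f(Λ) l(1)`: by the trace formula and the Nakayama
automorphism it is `∑ l(Λ₁ S(Λ₂)) f(Λ₃)`. -/
theorem trace_antipode_antipode_contractRight (hΛ : IsNormalizedIntegral k Λ)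
    (hl : contractLeft l Λ = 1) (f : H →ₗ[k] k) :
    LinearMap.trace k H (antipode k ∘ₗ antipode k ∘ₗ contractRight f) = f Λ * l 1 := by
  rw [hΛ.trace_eq_sum hl _ (ℛ k Λ)]
  simp only [LinearMap.comp_apply, ← hΛ.apply_mul hl]
  have h1 := mul_antipode_lTensor_comul_apply (R := k) (contractRight f Λ)
  rw [comul_contractRight, ← (ℛ k Λ).eq, counit_contractRight] at h1
  simp only [map_sum, LinearMap.lTensor_tmul, LinearMap.mul'_apply] at h1
  rw [← map_sum, h1, Algebra.algebraMap_eq_smul_one, map_smul, smul_eq_mul]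

end IsNormalizedIntegral

end Frobenius

/-! ### Positivity of sums over roots of unity -/

section RootsOfUnity

open Polynomial

/-- The traces of the powers of a matrix `a` with `aᴺ = 1` are the values at the powers of a
primitive `N`-th root of unity of one polynomial, whose coefficients are the multiplicities of the
eigenvalues of `a`. -/
theorem exists_polynomial_trace_pow {k n : Type*} [Field k] [CharZero k] [Fintype n]
    [DecidableEq n] {N : ℕ} (hN : 0 < N) {ζ : k} (hζ : IsPrimitiveRoot ζ N)
    {a : Matrix n n k} (ha : a ^ N = 1) :
    ∃ p : ℚ[X], ∀ s : ℕ, (a ^ s).trace = aeval (ζ ^ s) p := by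
  have hζ0 : ζ ≠ 0 := hζ.ne_zero hN.ne'
  have hN0 : (N : k) ≠ 0 := by exact_mod_cast hN.ne'
  let u : ℕ → Matrix n n k := fun j => (ζ⁻¹ ^ j) • a
  -- `E j` is the projection to the eigenspace of `a` for `ζ ^ j`.
  let E : ℕ → Matrix n n k := fun j => (N : k)⁻¹ • ∑ l ∈ Finset.range N, u j ^ l
  have hu : ∀ j, u j * E j = E j := fun j => by
    have h1 := mul_geom_sum (u j) N
    have h2 : u j ^ N = 1 := by
      simp only [u, _root_.smul_pow, ha]
      rw [← pow_mul, mul_comm, pow_mul, inv_pow, hζ.pow_eq_one, inv_one, one_pow, one_smul]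
    rw [h2, sub_self, sub_mul, one_mul, sub_eq_zero] at h1
    simp only [E, mul_smul_comm, h1]
  have haE : ∀ s j, a ^ s * E j = ((ζ ^ s) ^ j) • E j := fun s j => by
    have h1 : a * E j = ζ ^ j • E j := by
      conv_rhs => rw [← hu j]
      simp only [u, smul_mul_assoc, smul_smul, ← mul_pow, mul_inv_cancel₀ hζ0, one_pow, one_smul]
    induction s with
    | zero => simp
    | succ s ih => rw [pow_succ, mul_assoc, h1, mul_smul_comm, ih, smul_smul]; ring_nf
  have hE : ∀ j, IsIdempotentElem (E j) := fun j => by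
    have h1 : ∀ l, u j ^ l * E j = E j := fun l => by
      induction l with
      | zero => simp
      | succ l ih => rw [pow_succ, mul_assoc, hu, ih]
    rw [IsIdempotentElem]
    conv_lhs => enter [1]; simp only [E]
    rw [smul_mul_assoc, Finset.sum_mul, Finset.sum_congr rfl fun l _ => h1 l]
    simp [← Nat.cast_smul_eq_nsmul k, smul_smul, hN0]
  have hsum : ∑ j ∈ Finset.range N, E j = 1 := by
    simp only [E, ← Finset.smul_sum]
    rw [Finset.sum_comm, Finset.sum_eq_single 0]
    · simp [← Nat.cast_smul_eq_nsmul k, smul_smul, hN0]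
    · intro l hl hl0
      simp only [u, _root_.smul_pow, ← Finset.sum_smul]
      have h1 : ∑ j ∈ Finset.range N, (ζ⁻¹ ^ j) ^ l = 0 := by
        have h2 : ζ⁻¹ ^ l ≠ 1 := by
          rw [inv_pow, ne_eq, inv_eq_one]
          exact hζ.pow_ne_one_of_pos_of_lt hl0 (Finset.mem_range.1 hl)
        have h3 := mul_geom_sum (ζ⁻¹ ^ l) N
        rw [← pow_mul, mul_comm l, pow_mul, inv_pow ζ N, hζ.pow_eq_one, inv_one,
          one_pow, sub_self] at h3
        rw [← (mul_eq_zero.1 h3).resolve_left (sub_ne_zero.2 h2)]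
        exact Finset.sum_congr rfl fun j _ => by rw [← pow_mul, ← pow_mul, mul_comm]
      rw [h1, zero_smul]
    · exact fun h => absurd (Finset.mem_range.2 hN) h
  have hrank : ∀ j, ∃ m : ℕ, (E j).trace = m := fun j => by
    have h1 : IsIdempotentElem (Matrix.toLin' (E j)) := by
      rw [IsIdempotentElem, Module.End.mul_eq_comp, ← Matrix.toLin'_mul, hE j]
    rw [← Matrix.trace_toLin'_eq]
    exact ⟨_, (LinearMap.IsIdempotentElem.isProj_range _ h1).trace⟩
  choose m hm using hrank
  refine ⟨∑ j ∈ Finset.range N, (m j : ℚ[X]) * X ^ j, fun s => ?_⟩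
  rw [← mul_one (a ^ s), ← hsum, Finset.mul_sum, Matrix.trace_sum]
  simp only [haE, Matrix.trace_smul, hm, map_sum, map_mul, map_natCast, map_pow, aeval_X]
  exact Finset.sum_congr rfl fun j _ => by simp [mul_comm]

theorem aeval_eq_zero_iff_of_isPrimitiveRoot {K L : Type*} [Field K] [Field L] [CharZero K]
    [CharZero L] {N : ℕ} (hN : 0 < N) {ζ : K} {ω : L} (hζ : IsPrimitiveRoot ζ N)
    (hω : IsPrimitiveRoot ω N) (p : ℚ[X]) : aeval ζ p = 0 ↔ aeval ω p = 0 := by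
  rw [← minpoly.dvd_iff, ← minpoly.dvd_iff, ← cyclotomic_eq_minpoly_rat hζ hN,
    ← cyclotomic_eq_minpoly_rat hω hN]

/-- A sum `∑ p(ζ) p(ζ⁻¹)` over rational polynomials `p` vanishes only if all `p(ζ)` do: this does
not depend on the primitive root of unity `ζ`, and over `ℂ` it is a sum of squares of absolute
values. -/
theorem aeval_eq_zero_of_sum_mul_eq_zero {k ι : Type*} [Field k] [CharZero k] [Fintype ι]
    {N : ℕ} (hN : 0 < N) {ζ : k} (hζ : IsPrimitiveRoot ζ N) (p : ι → ℚ[X])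
    (h : ∑ i, aeval ζ (p i) * aeval (ζ ^ (N - 1)) (p i) = 0) (i : ι) : aeval ζ (p i) = 0 := by
  have hω := Complex.isPrimitiveRoot_exp N hN.ne'
  set ω := Complex.exp (2 * Real.pi * Complex.I / N)
  rw [aeval_eq_zero_iff_of_isPrimitiveRoot hN hζ hω]
  have h1 : aeval ζ (∑ i, p i * (p i).comp (X ^ (N - 1))) = 0 := by
    simpa [aeval_comp] using h
  rw [aeval_eq_zero_iff_of_isPrimitiveRoot hN hζ hω] at h1
  have hconj : ω ^ (N - 1) = (starRingEnd ℂ) ω := by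
    have h2 : ω * ω ^ (N - 1) = 1 := by
      rw [← pow_succ', Nat.sub_add_cancel hN, hω.pow_eq_one]
    have h3 : ‖ω‖ = 1 := hω.norm'_eq_one hN.ne'
    rw [← Complex.inv_eq_conj h3]
    exact eq_inv_of_mul_eq_one_right h2
  have h4 : ∀ q : ℚ[X], aeval ((starRingEnd ℂ) ω) q = (starRingEnd ℂ) (aeval ω q) := fun q =>
    aeval_algHom_apply ((Complex.conjAe : ℂ →ₐ[ℝ] ℂ).restrictScalars ℚ) ω q
  simp only [map_sum, map_mul, aeval_comp, map_pow, aeval_X, hconj, h4, Complex.mul_conj] at h1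
  have h5 : ∑ i, Complex.normSq (aeval ω (p i)) = 0 := by exact_mod_cast h1
  exact Complex.normSq_eq_zero.1 ((Finset.sum_eq_zero_iff_of_nonneg fun i _ =>
    Complex.normSq_nonneg _).1 h5 i (Finset.mem_univ i))

/-- Positivity of `∑ tr(bᵢ) tr(bᵢ⁻¹)` for matrices with a scalar power: after rescaling, the `bᵢ`
have finite order, and then `tr(bᵢ⁻¹)` is the complex conjugate of `tr(bᵢ)`. -/
theorem sum_trace_mul_trace_ne_zero {k ι : Type*} [Field k] [IsAlgClosed k] [CharZero k]
    [Fintype ι] {n : ι → Type*} [∀ i, Fintype (n i)] [∀ i, DecidableEq (n i)]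
    (b c : ∀ i, Matrix (n i) (n i) k) (hbc : ∀ i, b i * c i = 1) {N : ℕ} (hN : 0 < N)
    (hb : ∀ i, ∃ γ : k, γ ≠ 0 ∧ b i ^ N = γ • 1) {i₀ : ι} (hi₀ : (b i₀).trace ≠ 0) :
    ∑ i, (b i).trace * (c i).trace ≠ 0 := by
  have : NeZero (N : k) := ⟨by exact_mod_cast hN.ne'⟩
  obtain ⟨ζ, hζ⟩ := HasEnoughRootsOfUnity.exists_primitiveRoot k N
  choose γ hγ0 hγ using hb
  choose r hr using fun i => IsAlgClosed.exists_pow_nat_eq (γ i) hN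
  have hr0 : ∀ i, r i ≠ 0 := fun i h => hγ0 i (by rw [← hr, h, zero_pow hN.ne'])
  have ha : ∀ i, ((r i)⁻¹ • b i) ^ N = 1 := fun i => by
    rw [_root_.smul_pow, hγ, smul_smul, ← hr, inv_pow,
      inv_mul_cancel₀ (pow_ne_zero _ (hr0 i)), one_smul]
  have hc : ∀ i, ((r i)⁻¹ • b i) ^ (N - 1) = r i • c i := fun i => by
    have h1 : ((r i)⁻¹ • b i) ^ (N - 1) * ((r i)⁻¹ • b i) = 1 := by
      rw [← pow_succ, Nat.sub_add_cancel hN, ha]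
    refine left_inv_eq_right_inv h1 ?_
    rw [smul_mul_smul_comm, inv_mul_cancel₀ (hr0 i), one_smul, hbc]
  choose p hp using fun i => exists_polynomial_trace_pow hN hζ (ha i)
  intro h
  have h0 : ∀ i, aeval ζ (p i) = (r i)⁻¹ * (b i).trace := fun i => by
    rw [← pow_one ζ, ← hp, pow_one, Matrix.trace_smul, smul_eq_mul]
  have h2 := aeval_eq_zero_of_sum_mul_eq_zero hN hζ p (by
    rw [← h]
    refine Finset.sum_congr rfl fun i _ => ?_
    rw [← hp, hc, h0, Matrix.trace_smul, smul_eq_mul]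
    have := hr0 i
    field_simp) i₀
  rw [h0] at h2
  exact mul_ne_zero (inv_ne_zero (hr0 i₀)) hi₀ h2

end RootsOfUnity

/-! ### The integral of the dual does not vanish at one -/

section MatrixProducts

variable {k ι : Type*} [Field k] [Fintype ι] [DecidableEq ι] {n : ι → Type*}
  [∀ i, Fintype (n i)] [∀ i, DecidableEq (n i)]

theorem eq_sum_smul_single (x : ∀ i, Matrix (n i) (n i) k) :
    x = ∑ i, ∑ p, ∑ q, x i p q • Pi.single i (Matrix.single p q (1 : k)) := by
  conv_lhs => rw [← Finset.univ_sum_single x]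
  refine Finset.sum_congr rfl fun i _ => ?_
  conv_lhs => rw [Matrix.matrix_eq_sum_single (x i)]
  simp_rw [← Pi.single_smul, Matrix.smul_single, smul_eq_mul, mul_one,
    ← LinearMap.coe_single (R := k), map_sum]

/-- Every functional on a product of matrix algebras is represented through the trace. -/
theorem exists_eq_sum_trace_mul (φ : (∀ i, Matrix (n i) (n i) k) →ₗ[k] k) :
    ∃ b : ∀ i, Matrix (n i) (n i) k, ∀ x, φ x = ∑ i, (b i * x i).trace := by
  refine ⟨fun i => Matrix.of fun p q => φ (Pi.single i (Matrix.single q p 1)), fun x => ?_⟩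
  conv_lhs => rw [eq_sum_smul_single x]
  simp only [map_sum, map_smul, smul_eq_mul, Matrix.trace, Matrix.diag, Matrix.mul_apply,
    Matrix.of_apply]
  refine Finset.sum_congr rfl fun i _ => ?_
  rw [Finset.sum_comm]
  exact Finset.sum_congr rfl fun p _ => Finset.sum_congr rfl fun q _ => mul_comm _ _

theorem trace_mulLeft_comp_mulRight (c b : ∀ i, Matrix (n i) (n i) k) :
    LinearMap.trace k (∀ i, Matrix (n i) (n i) k)
      (LinearMap.mulLeft k c ∘ₗ LinearMap.mulRight k b) = ∑ i, (c i).trace * (b i).trace := by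
  have hF : LinearMap.mulLeft k c ∘ₗ LinearMap.mulRight k b = ∑ i, ∑ p, ∑ q,
      (Matrix.entryLinearMap k k p q ∘ₗ LinearMap.proj i).smulRight
        (c * ((Pi.single i (Matrix.single p q 1) : ∀ i, Matrix (n i) (n i) k) * b)) := by
    refine LinearMap.ext fun x => ?_
    conv_lhs => rw [eq_sum_smul_single x]
    simp [LinearMap.sum_apply]
  rw [hF]
  simp only [map_sum, LinearMap.trace_smulRight]
  refine Finset.sum_congr rfl fun i _ => ?_
  rw [Matrix.trace, Matrix.trace, Finset.sum_mul_sum]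
  refine Finset.sum_congr rfl fun p _ => Finset.sum_congr rfl fun q _ => ?_
  simp [Matrix.mul_apply, Matrix.single_apply, Finset.sum_ite_eq, ite_and]

end MatrixProducts

section LarsonRadford

variable {k H : Type*} [Field k] [Ring H] [HopfAlgebra k H]

variable (k H) in
/-- The square of the antipode, as an algebra endomorphism. -/
def antipodeSq : H →ₐ[k] H :=
  AlgHom.ofLinearMap (antipode k ∘ₗ antipode k) (by simp)
    (fun x y => by simp [antipode_mul_antidistrib])

theorem antipodeSq_apply (x : H) : antipodeSq k H x = antipode k (antipode k x) := rfl

theorem exists_pow_eq_one_of_isGroupLikeElem [FiniteDimensional k H] {g : H}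
    (hg : IsGroupLikeElem k g) : ∃ N, 0 < N ∧ g ^ N = 1 := by
  have : Finite (GroupLike k H) := (linearIndep_groupLikeVal (R := k) (A := H)).finite
  let g' : GroupLike k H := ⟨g, hg⟩
  obtain ⟨N, hN, h⟩ := isOfFinOrder_iff_pow_eq_one.1 (isOfFinOrder_of_finite g')
  exact ⟨N, hN, by simpa using congrArg GroupLike.val h⟩

namespace IsNormalizedIntegral

variable {Λ : H} {l : H →ₗ[k] k}

/-- The square of the antipode has finite order, because `S⁴` is conjugation by a group-like
element. -/
theorem exists_iterate_antipodeSq (hΛ : IsNormalizedIntegral k Λ) :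
    ∃ N, 0 < N ∧ ∀ x, (antipodeSq k H)^[N] x = x := by
  have := hΛ.finiteDimensional
  obtain ⟨l, hl⟩ := hΛ.exists_contractLeft_eq_one
  obtain ⟨N, hN, hg⟩ := exists_pow_eq_one_of_isGroupLikeElem (hΛ.isGroupLikeElem hl)
  refine ⟨2 * N, by omega, fun x => ?_⟩
  have key : ∀ n, contractRight l Λ ^ n * x =
      (antipodeSq k H)^[2 * n] x * contractRight l Λ ^ n := fun n => by
    induction n with
    | zero => simp
    | succ n ih =>
      rw [pow_succ', mul_assoc, ih, ← mul_assoc, hΛ.mul_eq_antipode_pow_four_mul hl, mul_assoc,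
        ← pow_succ', mul_add, mul_one, add_comm (2 * n), Function.iterate_add_apply]
      rfl
  have := key N
  rw [hg, one_mul, mul_one] at this
  exact this.symm


/-- The trace `l(1)` of the square of the antipode is nonzero: this square is conjugation by an
element `b` with a central power, so its trace is `∑ tr(bᵢ) tr(bᵢ⁻¹)` over the matrix blocks. -/
theorem apply_one_ne_zero [IsAlgClosed k] [CharZero k] [IsSemisimpleRing H]
    (hΛ : IsNormalizedIntegral k Λ) (hl : contractLeft l Λ = 1) : l 1 ≠ 0 := by
  have := hΛ.finiteDimensional
  obtain ⟨N, hN, hS⟩ := hΛ.exists_iterate_antipodeSq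
  obtain ⟨n, d, hd, ⟨e⟩⟩ := IsSemisimpleRing.exists_algEquiv_pi_matrix_of_isAlgClosed k H
  -- The reduced trace `T` is a nondegenerate symmetric form, and `l = T(b ·)` for some `b`.
  obtain ⟨b', hb'⟩ := exists_eq_sum_trace_mul (l ∘ₗ e.symm.toLinearMap)
  let T : H →ₗ[k] k := ∑ i,
    Matrix.traceLinearMap (Fin (d i)) k k ∘ₗ LinearMap.proj i ∘ₗ e.toLinearMap
  have hT : ∀ x, T x = ∑ i, (e x i).trace := fun x => by simp [T]
  have hTcomm : ∀ x y, T (x * y) = T (y * x) := fun x y => by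
    simp only [hT, map_mul, Pi.mul_apply]
    exact Finset.sum_congr rfl fun i _ => Matrix.trace_mul_comm _ _
  have hTnd : ∀ x, (∀ y, T (x * y) = 0) → x = 0 := fun x hx => by
    apply e.injective
    rw [map_zero]
    funext i
    refine Matrix.ext_iff_trace_mul_right.2 fun y => ?_
    have := hx (e.symm (Pi.single i y))
    rw [hT, Finset.sum_eq_single i] at this
    · simpa using this
    · intro j _ hj
      simp [hj]
    · simp
  obtain ⟨b, rfl⟩ := e.surjective b'
  have hlb : ∀ x, l x = T (b * x) := fun x => by
    have := hb' (e x)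
    simpa [hT] using this
  -- Since `S²` is the Nakayama automorphism of `l`, it is conjugation by `b`.
  have hconj : ∀ y, y * b = b * antipodeSq k H y := fun y => by
    rw [← sub_eq_zero]
    refine hTnd _ fun x => ?_
    have := hΛ.apply_mul hl x y
    rw [hlb, hlb, ← mul_assoc, hTcomm (b * x), ← antipodeSq_apply] at this
    rw [sub_mul, map_sub, mul_assoc, this, mul_assoc, sub_self]
  have hinj : Function.Injective (LinearMap.mulLeft k b) := by
    rw [← LinearMap.ker_eq_bot, LinearMap.ker_eq_bot']
    intro x hx
    refine hΛ.eq_of_forall_apply_mul hl fun z => ?_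
    rw [hlb, ← mul_assoc, show b * x = 0 from hx, zero_mul,
      map_zero, map_zero]
  obtain ⟨c, hbc⟩ := LinearMap.injective_iff_surjective.1 hinj 1
  replace hbc : b * c = 1 := hbc
  have hcb : c * b = 1 := hinj (by
    simp only [LinearMap.mulLeft_apply]
    rw [← mul_assoc, hbc, one_mul, mul_one])
  have hσ : ∀ y, antipodeSq k H y = c * y * b := fun y => by
    rw [mul_assoc, hconj, ← mul_assoc, hcb, one_mul]
  have hpow : ∀ n y, y * b ^ n = b ^ n * (antipodeSq k H)^[n] y := fun n => by
    induction n with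
    | zero => simp
    | succ n ih =>
      intro y
      rw [pow_succ', ← mul_assoc, hconj, mul_assoc, ih, ← mul_assoc]
      rfl
  -- As `S²` has finite order, a power of `b` is central, hence scalar on each block.
  have hcent : ∀ y, y * b ^ N = b ^ N * y := fun y => by rw [hpow, hS]
  have hscalar : ∀ z : H, (∀ y, y * z = z * y) → ∀ i, ∃ γ : k, e z i = γ • 1 := fun z hz i => by
    obtain ⟨γ, hγ⟩ := Matrix.mem_range_scalar_of_commute_single (M := e z i) fun p q _ => by
      have := congrFun (congrArg e (hz (e.symm (Pi.single i (Matrix.single p q 1))))) i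
      simpa [Commute, SemiconjBy] using this
    exact ⟨γ, by rw [← hγ, Matrix.smul_one_eq_diagonal]; rfl⟩
  have hbce : ∀ i, e b i * e c i = 1 := fun i => by
    rw [← Pi.mul_apply, ← map_mul, hbc, map_one, Pi.one_apply]
  have htr : LinearMap.trace k H (antipodeSq k H).toLinearMap =
      ∑ i, (e b i).trace * (e c i).trace := by
    have h1 : e.toLinearEquiv.conj (antipodeSq k H).toLinearMap =
        LinearMap.mulLeft k (e c) ∘ₗ LinearMap.mulRight k (e b) := by
      refine LinearMap.ext fun x => ?_
      simp [LinearEquiv.conj_apply, hσ, mul_assoc]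
    rw [← LinearMap.trace_conj' _ e.toLinearEquiv, h1, trace_mulLeft_comp_mulRight]
    simp only [mul_comm]
  have htr' : LinearMap.trace k H (antipodeSq k H).toLinearMap = l 1 := by
    have := hΛ.trace_antipode_antipode_contractRight hl (counit (R := k))
    rw [hΛ.counit_eq_one, one_mul] at this
    rw [← this]
    congr 1
    ext x
    simp [contractRight_counit, antipodeSq_apply]
  rw [← htr', htr]
  -- On a block where the central element `Λ` is nonzero, `b` is the nonzero scalar `ε(b)`.
  have hΛ0 : e Λ ≠ 0 := fun h => by
    rw [map_eq_zero_iff _ e.injective] at h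
    simpa [h] using hΛ.counit_eq_one
  obtain ⟨i₀, hi₀⟩ := Function.ne_iff.1 hΛ0
  have hbi : (e b i₀).trace ≠ 0 := by
    obtain ⟨γ, hγ⟩ := hscalar Λ (fun y => by rw [hΛ.mul_left, hΛ.mul_right]) i₀
    have hγ0 : γ ≠ 0 := fun h => hi₀ (by rw [hγ, h, zero_smul]; rfl)
    have h1 := congrFun (congrArg e (hΛ.mul_left b)) i₀
    rw [map_mul, Pi.mul_apply, map_smul, Pi.smul_apply, hγ, mul_smul_comm, mul_one,
      smul_comm, smul_right_inj hγ0] at h1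
    have h2 : (counit b : k) ≠ 0 := fun h => by
      have h3 := congrArg (counit (R := k)) hbc
      rw [Bialgebra.counit_mul, h, zero_mul, Bialgebra.counit_one] at h3
      exact zero_ne_one h3
    rw [h1, Matrix.trace_smul, Matrix.trace_one, Fintype.card_fin, smul_eq_mul]
    exact mul_ne_zero h2 (by exact_mod_cast (hd i₀).out)
  refine sum_trace_mul_trace_ne_zero (fun i => e b i) (fun i => e c i) hbce hN (fun i => ?_) hbi
  obtain ⟨γ, hγ⟩ := hscalar _ hcent i
  rw [map_pow, Pi.pow_apply] at hγ
  refine ⟨γ, fun h => ?_, hγ⟩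
  have h1 : e b i ^ N * e c i ^ N = 1 := by
    rw [← Commute.mul_pow, hbce, one_pow]
    have : e c i * e b i = 1 := by
      rw [← Pi.mul_apply, ← map_mul, hcb, map_one, Pi.one_apply]
    exact (hbce i).trans this.symm
  have := hd i
  rw [hγ, h, zero_smul, zero_mul] at h1
  exact zero_ne_one h1

end IsNormalizedIntegral

end LarsonRadford

/-! ### The antipode is an involution -/

section Involution

variable {k V : Type*} [Field k] [CharZero k] [AddCommGroup V] [Module k V] [FiniteDimensional k V]

/-- An endomorphism `A` with `A³ = A` has eigenvalues `1`, `-1` and `0`; here `a` and `b` are the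
multiplicities of `1` and `-1`. -/
theorem exists_trace_eq_sub_of_pow_three {A : Module.End k V} (hA : A ^ 3 = A) :
    ∃ a b : ℕ, LinearMap.trace k V A = a - b ∧ LinearMap.trace k V (A ^ 2) = a + b ∧
      (a = 0 → A ^ 2 = -A) ∧ (b = 0 → A ^ 2 = A) := by
  have h4 : A ^ 4 = A ^ 2 := by rw [pow_succ, hA, sq]
  have hp : IsIdempotentElem ((2 : k)⁻¹ • (A ^ 2 + A)) := by
    rw [IsIdempotentElem, smul_mul_smul_comm]
    have : (A ^ 2 + A) * (A ^ 2 + A) = (2 : k) • (A ^ 2 + A) := by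
      rw [two_smul]
      calc _ = A ^ 4 + A ^ 3 + A ^ 3 + A ^ 2 := by noncomm_ring
        _ = _ := by rw [h4, hA]; abel
    rw [this, smul_smul]
    norm_num
  have hm : IsIdempotentElem ((2 : k)⁻¹ • (A ^ 2 - A)) := by
    rw [IsIdempotentElem, smul_mul_smul_comm]
    have : (A ^ 2 - A) * (A ^ 2 - A) = (2 : k) • (A ^ 2 - A) := by
      rw [two_smul]
      calc _ = A ^ 4 - A ^ 3 - A ^ 3 + A ^ 2 := by noncomm_ring
        _ = _ := by rw [h4, hA]; abel
    rw [this, smul_smul]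
    norm_num
  obtain ⟨a, hp'⟩ : ∃ a : ℕ, LinearMap.trace k V ((2 : k)⁻¹ • (A ^ 2 + A)) = a :=
    ⟨_, (LinearMap.IsIdempotentElem.isProj_range _ hp).trace⟩
  obtain ⟨b, hm'⟩ : ∃ b : ℕ, LinearMap.trace k V ((2 : k)⁻¹ • (A ^ 2 - A)) = b :=
    ⟨_, (LinearMap.IsIdempotentElem.isProj_range _ hm).trace⟩
  have h2 : (2 : k)⁻¹ ≠ 0 := by norm_num
  refine ⟨a, b, ?_, ?_, fun h => ?_, fun h => ?_⟩
  · rw [← hp', ← hm', ← map_sub, ← smul_sub]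
    congr 1
    rw [add_sub_sub_cancel, ← two_smul k A, smul_smul]
    norm_num
  · rw [← hp', ← hm', ← map_add, ← smul_add]
    congr 1
    rw [add_add_sub_cancel, ← two_smul k (A ^ 2), smul_smul]
    norm_num
  · rw [h, Nat.cast_zero, LinearMap.IsIdempotentElem.trace_eq_zero_iff hp, smul_eq_zero] at hp'
    exact eq_neg_of_add_eq_zero_left (hp'.resolve_left h2)
  · rw [h, Nat.cast_zero, LinearMap.IsIdempotentElem.trace_eq_zero_iff hm, smul_eq_zero] at hm'
    exact sub_eq_zero.1 (hm'.resolve_left h2)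

end Involution

section LarsonRadford

variable {k H : Type*} [Field k] [Ring H] [HopfAlgebra k H]

variable (k H) in
/-- The character of the regular representation. -/
def regularCharacter : H →ₗ[k] k := LinearMap.trace k H ∘ₗ (Algebra.lmul k H).toLinearMap

theorem regularCharacter_apply (h : H) :
    regularCharacter k H h = LinearMap.trace k H (Algebra.lmul k H h) := rfl

variable (k H) in
/-- The map `x ⊗ y ↦ ∑ x₁ ⊗ x₂ y`, which identifies the tensor product of the regular
representation and the trivial representation on `H` with the tensor square of the regular
representation. -/
def galoisMap : H ⊗[k] H →ₗ[k] H ⊗[k] H :=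
  TensorProduct.lift ((LinearMap.mul k (H ⊗[k] H)).compl₁₂ comul (inclRight k H).toLinearMap)

theorem galoisMap_tmul (x y : H) : galoisMap k H (x ⊗ₜ y) = comul x * (1 ⊗ₜ y) := by
  simp [galoisMap]

theorem galoisMap_surjective : Function.Surjective (galoisMap k H) := by
  rw [← LinearMap.range_eq_top, eq_top_iff]
  intro z _
  induction z using TensorProduct.induction_on with
  | zero => exact Submodule.zero_mem _
  | add x y hx hy => exact Submodule.add_mem _ (hx trivial) (hy trivial)
  | tmul x y =>
    refine ⟨∑ i ∈ (ℛ k x).index, (ℛ k x).left i ⊗ₜ (antipode k ((ℛ k x).right i) * y), ?_⟩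
    have := congrArg (· * ((1 : H) ⊗ₜ[k] y)) (sum_comul_mul_one_tmul_antipode (ℛ k x))
    simpa [galoisMap_tmul, Finset.sum_mul, mul_assoc] using this

/-- The convolution square of the regular character is `χ * χ = n χ` with `n = dim H`, since the
tensor square of the regular representation is a sum of `n` copies of it. -/
theorem regularCharacter_comp_contractRight [FiniteDimensional k H] :
    regularCharacter k H ∘ₗ contractRight (regularCharacter k H) =
      (Module.finrank k H : k) • regularCharacter k H := by
  ext h
  let Ψ : H ⊗[k] H ≃ₗ[k] H ⊗[k] H := LinearEquiv.ofBijective (galoisMap k H)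
    ⟨LinearMap.injective_iff_surjective.2 galoisMap_surjective, galoisMap_surjective⟩
  have h1 : Ψ.conj ((Algebra.lmul k H h).rTensor H) =
      Algebra.lmul k (H ⊗[k] H) (comul h) := by
    rw [LinearEquiv.conj_apply, LinearEquiv.comp_toLinearMap_symm_eq]
    refine TensorProduct.ext' fun x y => ?_
    change galoisMap k H ((h * x) ⊗ₜ y) = comul h * galoisMap k H (x ⊗ₜ y)
    rw [galoisMap_tmul, galoisMap_tmul, Bialgebra.comul_mul, mul_assoc]
  have h2 : Algebra.lmul k (H ⊗[k] H) (comul h) = ∑ i ∈ (ℛ k h).index,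
      TensorProduct.map (Algebra.lmul k H ((ℛ k h).left i))
        (Algebra.lmul k H ((ℛ k h).right i)) := by
    rw [← (ℛ k h).eq, map_sum]
    refine Finset.sum_congr rfl fun i _ => TensorProduct.ext' fun x y => ?_
    simp
  have h3 := congrArg (LinearMap.trace k _) (h1.trans h2)
  rw [LinearMap.trace_conj', LinearMap.rTensor, LinearMap.trace_tensorProduct', map_sum,
    LinearMap.trace_id] at h3
  simp only [LinearMap.trace_tensorProduct'] at h3
  rw [LinearMap.comp_apply, contractRight_eq_sum _ (ℛ k h), LinearMap.smul_apply, smul_eq_mul,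
    mul_comm, regularCharacter_apply h, h3]
  simp [regularCharacter_apply, mul_comm]

namespace IsNormalizedIntegral

variable {Λ : H}

theorem regularCharacter_integral (hΛ : IsNormalizedIntegral k Λ) :
    regularCharacter k H Λ = 1 := by
  have := hΛ.finiteDimensional
  have h1 : Algebra.lmul k H Λ = (counit (R := k) (A := H)).smulRight Λ := by
    ext x
    simp [hΛ.mul_right]
  rw [regularCharacter_apply, h1, LinearMap.trace_smulRight, hΛ.counit_eq_one]

/-- **Larson–Radford**: the antipode of a semisimple Hopf algebra over an algebraically closed field
of characteristic zero is an involution. -/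
theorem antipode_antipode [IsAlgClosed k] [CharZero k] [IsSemisimpleRing H]
    (hΛ : IsNormalizedIntegral k Λ) (x : H) : antipode k (antipode k x) = x := by
  have := hΛ.finiteDimensional
  obtain ⟨l, hl⟩ := hΛ.exists_contractLeft_eq_one
  have hl1 := hΛ.apply_one_ne_zero hl
  let σ : Module.End k H := antipode k ∘ₗ antipode k
  have hσσ : σ * σ = 1 := LinearMap.ext fun x => hΛ.antipode_pow_four_eq hl hl1 x
  let χ := regularCharacter k H
  let P : Module.End k H := contractRight χ
  let n : k := Module.finrank k H
  have hH : Nontrivial H := ⟨Λ, 0, fun h => by simpa [h] using hΛ.counit_eq_one⟩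
  have hnpos : 0 < Module.finrank k H := Module.finrank_pos
  have hn : n ≠ 0 := Nat.cast_ne_zero.2 hnpos.ne'
  have hPP : P * P = n • P := LinearMap.ext fun x => by
    have := contractRight_contractRight χ χ x
    rw [regularCharacter_comp_contractRight, contractRight_eq_sum (_ • _) (ℛ k x)] at this
    simp only [LinearMap.smul_apply, smul_assoc] at this
    rwa [← Finset.smul_sum, ← contractRight_eq_sum _ (ℛ k x)] at this
  have hχσ : ∀ x, χ (σ x) = χ x := fun x => by
    have h1 : Algebra.lmul k H (σ x) = σ * (Algebra.lmul k H x * σ) := LinearMap.ext fun y => by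
      have h2 := LinearMap.congr_fun hσσ y
      have h3 := map_mul (antipodeSq k H) x (σ y)
      simp only [antipodeSq_apply] at h3
      change σ (x * σ y) = σ x * σ (σ y) at h3
      change σ x * y = σ (x * σ y)
      rw [h3]
      exact congrArg (σ x * ·) h2.symm
    rw [regularCharacter_apply, h1, LinearMap.trace_mul_comm, mul_assoc, hσσ, mul_one]
    rfl
  have hPσ : P * σ = σ * P := LinearMap.ext fun x => by
    change contractRight χ (antipode k (antipode k x)) = σ (contractRight χ x)
    rw [contractRight_eq_sum _ (ℛ k x), contractRight_apply, comul_antipode_antipode,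
      ← (ℛ k x).eq]
    simp only [map_sum, TensorProduct.map_tmul, LinearMap.lTensor_tmul, TensorProduct.rid_tmul,
      map_smul]
    exact Finset.sum_congr rfl fun i _ => congrArg (· • _) (hχσ _)
  -- `F` is `S²` composed with the commuting idempotent `n⁻¹ P`.
  let F : Module.End k H := n⁻¹ • (σ * P)
  have hFF : F ^ 2 = n⁻¹ • P := by
    rw [sq, smul_mul_smul_comm, mul_assoc, ← mul_assoc P, hPσ, mul_assoc, ← mul_assoc, hσσ,
      one_mul, hPP, smul_smul, mul_assoc, inv_mul_cancel₀ hn, mul_one]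
  have hF3 : F ^ 3 = F := by
    rw [pow_succ, hFF, smul_mul_smul_comm, ← mul_assoc, hPσ, mul_assoc, hPP, mul_smul_comm,
      smul_smul, mul_assoc, inv_mul_cancel₀ hn, mul_one]
  have hσ2 : σ ^ 2 = 1 := by rw [sq, hσσ]
  obtain ⟨a, b, hab, hab', ha, hb⟩ := exists_trace_eq_sub_of_pow_three (A := σ)
    (by rw [pow_succ, hσ2, one_mul])
  obtain ⟨c, d, hcd, -, -, -⟩ := exists_trace_eq_sub_of_pow_three hF3
  have htrF : n * LinearMap.trace k H F = l 1 := by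
    have := hΛ.trace_antipode_antipode_contractRight hl χ
    rw [hΛ.regularCharacter_integral, one_mul] at this
    rw [map_smul, smul_eq_mul, mul_inv_cancel_left₀ hn, ← this]
    rfl
  have htrσ : LinearMap.trace k H σ = l 1 := by
    have := hΛ.trace_antipode_antipode_contractRight hl (counit (R := k))
    rw [hΛ.counit_eq_one, one_mul] at this
    rw [← this]
    congr 1
    ext x
    simp [contractRight_counit, σ]
  rw [hσ2, LinearMap.trace_one] at hab'
  rw [hcd] at htrF
  rw [hab] at htrσ
  -- `a` and `b` are the multiplicities of the eigenvalues `1` and `-1` of `S²`. As `n` divides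
  -- `a - b ≠ 0` and `a + b = n`, one of them vanishes.
  have e1 : (a : ℤ) + b = Module.finrank k H := by exact_mod_cast hab'.symm
  have e2 : (Module.finrank k H : ℤ) * (c - d) = a - b := by
    have : (Module.finrank k H : k) * (c - d) = a - b := htrF.trans htrσ.symm
    exact_mod_cast this
  have e3 : (a : ℤ) - b ≠ 0 := fun h => hl1 (by
    rw [← htrσ]
    exact_mod_cast h)
  have hcd0 : (c : ℤ) - d ≠ 0 := fun h => e3 (by rw [← e2, h, mul_zero])
  have hpos : (0 : ℤ) < Module.finrank k H := by exact_mod_cast hnpos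
  have hor : a = 0 ∨ b = 0 := by
    rcases lt_or_gt_of_ne hcd0 with h | h
    · left
      have : (a : ℤ) ≤ 0 := by nlinarith
      omega
    · right
      have : (b : ℤ) ≤ 0 := by nlinarith
      omega
  rcases hor with h | h
  -- `S² = -1` is impossible because `S²(1) = 1`.
  · have h1 := LinearMap.congr_fun (ha h) 1
    rw [hσ2] at h1
    have h2 : (1 : H) = -1 := by simpa [σ] using h1
    have h3 := congrArg (counit (R := k)) h2
    rw [map_neg, Bialgebra.counit_one] at h3
    exact absurd h3 (by norm_num)
  · have h1 := LinearMap.congr_fun (hb h) x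
    rw [hσ2] at h1
    exact h1.symm

end IsNormalizedIntegral

end LarsonRadford

/-! ### Cyclic shifts, iterated comultiplications and invariants -/

section CyclicTrace

variable {k V : Type*} [Field k] [AddCommGroup V] [Module k V]

theorem cyclicShift_tprod {m : ℕ} (v : Fin m → V) :
    cyclicShift k V m (PiTensorProduct.tprod k v) =
      PiTensorProduct.tprod k fun i => v (finRotate m i) := by
  simp [cyclicShift]

/-- The product of the rank-one maps `vᵢ φᵢ` is a multiple of `v₀ φₙ`. -/
theorem prod_ofFn_smulRight (n : ℕ) (φ : Fin (n + 1) → Module.Dual k V) (v : Fin (n + 1) → V) :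
    (List.ofFn fun i => ((φ i).smulRight (v i) : Module.End k V)).prod =
      (∏ i : Fin n, φ i.castSucc (v i.succ)) • (φ (Fin.last n)).smulRight (v 0) := by
  induction n with
  | zero => simp
  | succ n ih =>
    rw [List.ofFn_succ, List.prod_cons, ih (fun i => φ i.succ) (fun i => v i.succ),
      Fin.prod_univ_succ]
    ext x
    simp [smul_smul, mul_comm, mul_assoc]

/-- The trace of the cyclic shift composed with `f₁ ⊗ ⋯ ⊗ fₘ` is the trace of `f₁ ⋯ fₘ`. Both sides
are multilinear, so it suffices to compare them on endomorphisms of rank one. -/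
theorem trace_cyclicShift_mul_map [FiniteDimensional k V] (n : ℕ)
    (f : Fin (n + 1) → Module.End k V) :
    LinearMap.trace k _ (cyclicShift k V (n + 1) * PiTensorProduct.map f) =
      LinearMap.trace k V (List.ofFn f).prod := by
  let b := Module.finBasis k V
  suffices h : (LinearMap.trace k _ ∘ₗ
      LinearMap.mulLeft k (cyclicShift k V (n + 1))).compMultilinearMap
      (PiTensorProduct.mapMultilinear k (fun _ : Fin (n + 1) => V) (fun _ : Fin (n + 1) => V)) =
      (LinearMap.trace k V).compMultilinearMap
        (MultilinearMap.mkPiAlgebraFin k (n + 1) (Module.End k V)) by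
    simpa using congrArg (fun g => g f) h
  refine Module.Basis.ext_multilinear (fun _ => b.end) fun j => ?_
  have hb : ∀ p, b.end p = (b.coord p.2).smulRight (b p.1) := fun p => b.ext fun q => by
    rw [Module.Basis.end_apply_apply]
    simp [Finsupp.single_apply, eq_comm]
  have hmap : PiTensorProduct.map (fun i => b.end (j i)) =
      (PiTensorProduct.lift ((MultilinearMap.mkPiAlgebra k (Fin (n + 1)) k).compLinearMap
        fun i => b.coord (j i).2)).smulRight (PiTensorProduct.tprod k fun i => b (j i).1) := by
    ext v
    simp [hb, MultilinearMap.map_smul_univ]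
  simp only [LinearMap.compMultilinearMap_apply, PiTensorProduct.mapMultilinear_apply, hmap,
    MultilinearMap.mkPiAlgebraFin_apply, LinearMap.comp_apply, LinearMap.mulLeft_apply]
  have h1 := prod_ofFn_smulRight n (fun i => b.coord (j i).2) (fun i => b (j i).1)
  simp only [← hb] at h1
  rw [h1, map_smul, LinearMap.trace_smulRight, Module.End.mul_eq_comp]
  have h2 : ∀ (g : Module.Dual k (⨂[k] _ : Fin (n + 1), V)) w,
      cyclicShift k V (n + 1) ∘ₗ g.smulRight w =
        g.smulRight (cyclicShift k V (n + 1) w) := fun g w => by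
    ext v
    simp
  rw [h2, LinearMap.trace_smulRight, cyclicShift_tprod, PiTensorProduct.lift.tprod,
    MultilinearMap.compLinearMap_apply, MultilinearMap.mkPiAlgebra_apply, Fin.prod_univ_castSucc]
  simp

end CyclicTrace

section IterComul

variable (k H : Type*) [Field k] [Ring H] [HopfAlgebra k H]

/-- The linear map `H^{⊗n} ⊗ H → H^{⊗(n+1)}`, `(h₁ ⊗ ⋯ ⊗ hₙ) ⊗ h ↦ h₁ ⊗ ⋯ ⊗ hₙ ⊗ h`. -/
def snocLinear (n : ℕ) : (⨂[k] _ : Fin n, H) ⊗[k] H →ₗ[k] ⨂[k] _ : Fin (n + 1), H :=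
  TensorProduct.lift (PiTensorProduct.lift
    (PiTensorProduct.tprod k (s := fun _ : Fin (n + 1) => H)).curryRight)

theorem snocLinear_tprod_tmul (n : ℕ) (h : H) (v : Fin n → H) :
    snocLinear k H n (PiTensorProduct.tprod k v ⊗ₜ h) =
      PiTensorProduct.tprod k (Fin.snoc v h : Fin (n + 1) → H) := by
  simp [snocLinear]

theorem consLinear_snocLinear (n : ℕ) (a b : H) (y : ⨂[k] _ : Fin n, H) :
    consLinear k H (n + 1) (a ⊗ₜ snocLinear k H n (y ⊗ₜ b)) =
      snocLinear k H (n + 1) (consLinear k H n (a ⊗ₜ y) ⊗ₜ b) := by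
  induction y using PiTensorProduct.induction_on with
  | smul_tprod r v =>
    simp only [← TensorProduct.smul_tmul', TensorProduct.tmul_smul, map_smul,
      snocLinear_tprod_tmul, consLinear_tmul_tprod, Fin.cons_snoc_eq_snoc_cons]
  | add x y hx hy =>
    simp only [TensorProduct.add_tmul, TensorProduct.tmul_add, map_add, hx, hy]

theorem iterComul_zero (h : H) :
    iterComul k H 0 h = (counit h : k) • PiTensorProduct.tprod k 1 := by
  rw [← PiTensorProduct.one_def, ← Algebra.algebraMap_eq_smul_one]
  rfl

theorem iterComul_succ (n : ℕ) (h : H) :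
    iterComul k H (n + 1) h =
      consLinear k H n ((iterComul k H n).toLinearMap.lTensor H (comul h)) := rfl

/-- The iterated comultiplication, with the last comultiplication applied to the first factor. -/
theorem iterComul_succ_eq_snocLinear (n : ℕ) (h : H) :
    iterComul k H (n + 1) h =
      snocLinear k H n ((iterComul k H n).toLinearMap.rTensor H (comul h)) := by
  induction n generalizing h with
  | zero =>
    have h1 : consLinear k H 0 ((iterComul k H 0).toLinearMap.lTensor H (comul h)) =
        consLinear k H 0 (h ⊗ₜ PiTensorProduct.tprod k 1) := by
      conv_rhs => rw [← contractRight_counit (k := k) h, contractRight_eq_sum _ (ℛ k h)]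
      rw [← (ℛ k h).eq]
      simp [iterComul_zero, TensorProduct.sum_tmul, TensorProduct.smul_tmul']
    have h2 : snocLinear k H 0 ((iterComul k H 0).toLinearMap.rTensor H (comul h)) =
        snocLinear k H 0 (PiTensorProduct.tprod k 1 ⊗ₜ h) := by
      conv_rhs => rw [← contractLeft_counit (k := k) h, contractLeft_eq_sum _ (ℛ k h)]
      rw [← (ℛ k h).eq]
      simp [iterComul_zero, TensorProduct.tmul_sum, ← TensorProduct.smul_tmul']
    rw [iterComul_succ, h1, h2, consLinear_tmul_tprod, snocLinear_tprod_tmul]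
    congr 1
    funext i
    obtain rfl : i = Fin.last 0 := by ext; omega
    exact (Fin.snoc_last (α := fun _ => H) h _).symm
  | succ n ih =>
    have h1 : ∀ x : H ⊗[k] H, consLinear k H (n + 1)
        ((iterComul k H (n + 1)).toLinearMap.lTensor H x) =
        consLinear k H (n + 1) ((snocLinear k H n).lTensor H
          (((iterComul k H n).toLinearMap.rTensor H).lTensor H (comul.lTensor H x))) := by
      intro x
      induction x using TensorProduct.induction_on with
      | zero => simp
      | add x y hx hy => simp only [map_add, hx, hy]
      | tmul a b => simp [ih]
    have h2 : ∀ x : H ⊗[k] H, snocLinear k H (n + 1)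
        ((iterComul k H (n + 1)).toLinearMap.rTensor H x) =
        consLinear k H (n + 1) ((snocLinear k H n).lTensor H
          (((iterComul k H n).toLinearMap.rTensor H).lTensor H
            (TensorProduct.assoc k H H H (comul.rTensor H x)))) := by
      intro x
      induction x using TensorProduct.induction_on with
      | zero => simp
      | add x y hx hy => simp only [map_add, hx, hy]
      | tmul a b =>
        rw [LinearMap.rTensor_tmul, LinearMap.rTensor_tmul, AlgHom.toLinearMap_apply,
          iterComul_succ, ← (ℛ k a).eq]
        simp [TensorProduct.sum_tmul, consLinear_snocLinear]
    rw [iterComul_succ, h1, h2, coassoc_apply]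

variable {k H}

theorem iterComul_map (τ : H →ₐc[k] H) (n : ℕ) (h : H) :
    iterComul k H n (τ h) =
      PiTensorProduct.map (fun _ : Fin n => (τ : H →ₐ[k] H).toLinearMap) (iterComul k H n h) := by
  induction n generalizing h with
  | zero =>
    rw [iterComul_zero, iterComul_zero, map_smul, PiTensorProduct.map_tprod,
      CoalgHomClass.counit_comp_apply]
    congr 2
    exact Subsingleton.elim _ _
  | succ n ih =>
    rw [iterComul_succ, iterComul_succ, ← CoalgHomClass.map_comp_comul_apply]
    generalize comul (R := k) h = x
    have hc : ∀ (a : H) (y : ⨂[k] _ : Fin n, H), consLinear k H n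
        (τ a ⊗ₜ PiTensorProduct.map (fun _ : Fin n => (τ : H →ₐ[k] H).toLinearMap) y) =
        PiTensorProduct.map (fun _ : Fin (n + 1) => (τ : H →ₐ[k] H).toLinearMap)
          (consLinear k H n (a ⊗ₜ y)) := fun a y => by
      induction y using PiTensorProduct.induction_on with
      | smul_tprod r v =>
        simp only [TensorProduct.tmul_smul, map_smul, PiTensorProduct.map_tprod,
          consLinear_tmul_tprod]
        congr 2
        funext i
        refine Fin.cases ?_ (fun j => ?_) i <;> simp
      | add x y hx hy =>
        simp only [TensorProduct.tmul_add, map_add, hx, hy]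
    induction x using TensorProduct.induction_on with
    | zero => simp
    | add x y hx hy => simp only [map_add, hx, hy]
    | tmul a b =>
      have := hc a (iterComul k H n b)
      rw [← ih] at this
      simpa using this

/-- The rotation `h₁ ⊗ ⋯ ⊗ hₙ ↦ hₙ ⊗ h₁ ⊗ ⋯ ⊗ hₙ₋₁`. -/
def rotate (n : ℕ) : (⨂[k] _ : Fin n, H) →ₗ[k] ⨂[k] _ : Fin n, H :=
  (PiTensorProduct.reindex k (fun _ : Fin n => H) (finRotate n)).toLinearMap

theorem rotate_tprod (n : ℕ) (v : Fin n → H) :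
    rotate n (PiTensorProduct.tprod k v) =
      PiTensorProduct.tprod k fun i => v ((finRotate n).symm i) := by
  simp [rotate]

theorem rotate_snocLinear (n : ℕ) (y : ⨂[k] _ : Fin n, H) (a : H) :
    rotate (n + 1) (snocLinear k H n (y ⊗ₜ a)) = consLinear k H n (a ⊗ₜ y) := by
  induction y using PiTensorProduct.induction_on with
  | smul_tprod r v =>
    simp only [← TensorProduct.smul_tmul', TensorProduct.tmul_smul, map_smul,
      snocLinear_tprod_tmul, consLinear_tmul_tprod, rotate_tprod]
    congr 2
    funext i
    obtain ⟨i, rfl⟩ := (finRotate (n + 1)).surjective i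
    rw [Equiv.symm_apply_apply]
    refine Fin.lastCases ?_ (fun i => ?_) i
    · simp
    · simp
  | add x y hx hy =>
    simp only [TensorProduct.add_tmul, TensorProduct.tmul_add, map_add, hx, hy]

theorem rotate_iterComul (n : ℕ) (h : H) :
    rotate (n + 1) (iterComul k H (n + 1) h) =
      consLinear k H n ((iterComul k H n).toLinearMap.lTensor H
        (TensorProduct.comm k H H (comul h))) := by
  rw [iterComul_succ_eq_snocLinear]
  generalize comul (R := k) h = x
  induction x using TensorProduct.induction_on with
  | zero => simp
  | add x y hx hy => simp only [map_add, hx, hy]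
  | tmul a b => simp [rotate_snocLinear]

end IterComul

section Invariants

variable {k H V : Type*} [Field k] [Ring H] [HopfAlgebra k H] [AddCommGroup V] [Module k V]

theorem iterate_twist_apply (ρ : H →ₐ[k] Module.End k V) (τ : H →ₐc[k] H) (i : ℕ) (h : H) :
    ((twist τ)^[i] ρ) h = ρ ((τ ^ i) h) := by
  induction i generalizing ρ with
  | zero => rfl
  | succ i ih =>
    rw [Function.iterate_succ_apply, ih]
    rw [pow_succ']
    rfl

/-- The action of `H^{⊗m}` on `V^{⊗m}` through the twists by the powers of `τ`. The twisted tensor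
power is, by definition, its composition with the iterated comultiplication. -/
def twistedAction (ρ : H →ₐ[k] Module.End k V) (τ : H →ₐc[k] H) (m : ℕ) :
    (⨂[k] _ : Fin m, H) →ₐ[k] Module.End k (⨂[k] _ : Fin m, V) :=
  PiTensorProduct.liftAlgHom
    ((PiTensorProduct.mapMultilinear k (fun _ : Fin m => V) (fun _ : Fin m => V)).compLinearMap
      (fun i => ((twist τ)^[i] ρ).toLinearMap))
    (by
      simp only [MultilinearMap.compLinearMap_apply, PiTensorProduct.mapMultilinear_apply,
        Pi.one_apply, AlgHom.toLinearMap_apply, map_one]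
      exact PiTensorProduct.map_one)
    (fun x y => by
      simp only [MultilinearMap.compLinearMap_apply, PiTensorProduct.mapMultilinear_apply,
        Pi.mul_apply, AlgHom.toLinearMap_apply, map_mul]
      exact PiTensorProduct.map_mul _ _)

theorem twistedAction_tprod (ρ : H →ₐ[k] Module.End k V) (τ : H →ₐc[k] H) (m : ℕ)
    (x : Fin m → H) :
    twistedAction ρ τ m (PiTensorProduct.tprod k x) =
      PiTensorProduct.map fun i : Fin m => ρ ((τ ^ (i : ℕ)) (x i)) := by
  simp only [← iterate_twist_apply]
  exact PiTensorProduct.lift.tprod _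

/-- The cyclic shift intertwines the action of a tensor with the action of its rotation. -/
theorem twistedAction_map_mul_cyclicShift (ρ : H →ₐ[k] Module.End k V) (τ : H →ₐc[k] H) (n : ℕ)
    (hτ : τ ^ (n + 1) = 1) (x : ⨂[k] _ : Fin (n + 1), H) :
    twistedAction ρ τ (n + 1)
        (PiTensorProduct.map (fun _ : Fin (n + 1) => (τ : H →ₐ[k] H).toLinearMap) x) *
        cyclicShift k V (n + 1) =
      cyclicShift k V (n + 1) * twistedAction ρ τ (n + 1) (rotate (n + 1) x) := by
  induction x using PiTensorProduct.induction_on with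
  | smul_tprod r x =>
    simp only [map_smul, smul_mul_assoc, mul_smul_comm, PiTensorProduct.map_tprod, rotate_tprod,
      twistedAction_tprod]
    congr 1
    refine PiTensorProduct.ext (MultilinearMap.ext fun v => ?_)
    simp only [LinearMap.compMultilinearMap_apply, Module.End.mul_apply, cyclicShift_tprod,
      PiTensorProduct.map_tprod]
    congr 1
    funext i
    congr 2
    have h1 : ∀ y, (τ ^ (i : ℕ)) (τ y) = (τ ^ ((finRotate (n + 1) i : Fin (n + 1)) : ℕ)) y := by
      intro y
      have h2 : (τ ^ (i : ℕ)) (τ y) = (τ ^ ((i : ℕ) + 1)) y := by rw [pow_succ]; rfl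
      rw [h2]
      refine Fin.lastCases ?_ (fun i => ?_) i
      · simp [hτ]
      · simp
    rw [Equiv.symm_apply_apply]
    exact h1 _
  | add x y hx hy => simp only [map_add, add_mul, mul_add, hx, hy]

/-- An invariant of a tensor product of two representations is also invariant under the opposite
comultiplication if the antipode is an involution. -/
theorem apply_comm_comul_of_antipode_antipode {M : Type*} [AddCommGroup M] [Module k M]
    (C : H ⊗[k] H →ₐ[k] Module.End k M) (hS : ∀ h : H, antipode k (antipode k h) = h) {w : M}
    (hw : ∀ h : H, C (comul h) w = (counit h : k) • w) (h : H) :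
    C (TensorProduct.comm k H H (comul h)) w = (counit h : k) • w := by
  have h1 : ∀ a b : H, C (b ⊗ₜ a) w = C ((b * antipode k a) ⊗ₜ 1) w := fun a b => by
    have := apply_one_tmul_eq_apply_antipode_tmul C hw a
    rw [← one_mul a, ← mul_one b, ← Algebra.TensorProduct.tmul_mul_tmul, map_mul,
      Module.End.mul_apply, this, ← Module.End.mul_apply, ← map_mul,
      Algebra.TensorProduct.tmul_mul_tmul]
    simp
  have h2 : ∑ i ∈ (ℛ k h).index, (ℛ k h).right i * antipode k ((ℛ k h).left i) =
      algebraMap k H (counit h) := by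
    have := congrArg (antipode k) (sum_mul_antipode_eq_smul (ℛ k h))
    simpa [antipode_mul_antidistrib, hS, Algebra.algebraMap_eq_smul_one] using this
  conv_lhs => rw [← (ℛ k h).eq]
  simp only [map_sum, TensorProduct.comm_tmul, LinearMap.sum_apply]
  rw [Finset.sum_congr rfl fun i _ => h1 _ _, ← LinearMap.sum_apply, ← map_sum,
    ← TensorProduct.sum_tmul, h2, Algebra.algebraMap_eq_smul_one, ← TensorProduct.smul_tmul',
    ← Algebra.TensorProduct.one_def,
    map_smul, map_one]
  rfl

/-- The cyclic shift preserves the invariants of the twisted tensor power, provided that the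
antipode is an involution. -/
theorem cyclicShift_mem_invariants (hS : ∀ h : H, antipode k (antipode k h) = h)
    (ρ : H →ₐ[k] Module.End k V) (τ : H ≃ₐc[k] H) (n : ℕ)
    (hτ : (τ : H →ₐc[k] H) ^ (n + 1) = 1) {w : ⨂[k] _ : Fin (n + 1), V}
    (hw : w ∈ invariants (twistedTensorPower ρ (τ : H →ₐc[k] H) (n + 1))) :
    cyclicShift k V (n + 1) w ∈ invariants (twistedTensorPower ρ (τ : H →ₐc[k] H) (n + 1)) := by
  intro h
  obtain ⟨h, rfl⟩ := τ.surjective h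
  have h1 := LinearMap.congr_fun (twistedAction_map_mul_cyclicShift ρ (τ : H →ₐc[k] H) n hτ
    (iterComul k H (n + 1) h)) w
  rw [← iterComul_map] at h1
  let C : H ⊗[k] H →ₐ[k] Module.End k (⨂[k] _ : Fin (n + 1), V) :=
    (twistedAction ρ (τ : H →ₐc[k] H) (n + 1)).comp ((consAlgHom k H n).comp
      (Algebra.TensorProduct.map (AlgHom.id k H) (iterComul k H n)))
  have h2 : C (TensorProduct.comm k H H (comul h)) w = (counit h : k) • w :=
    apply_comm_comul_of_antipode_antipode C hS (fun h => hw h) h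
  have h3 : C (TensorProduct.comm k H H (comul h)) =
      twistedAction ρ (τ : H →ₐc[k] H) (n + 1)
        (rotate (n + 1) (iterComul k H (n + 1) h)) := by
    rw [rotate_iterComul]
    rfl
  rw [h3] at h2
  rw [Module.End.mul_apply, Module.End.mul_apply, h2, map_smul] at h1
  refine h1.trans ?_
  congr 1
  exact (CoalgHomClass.counit_comp_apply τ h).symm

/-- The normalized integral acts as a projection to the invariants. -/
theorem isProj_invariants {W : Type*} [AddCommGroup W] [Module k W]
    (π : H →ₐ[k] Module.End k W) {Λ : H} (hΛ : IsNormalizedIntegral k Λ) :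
    LinearMap.IsProj (invariants π) (π Λ) where
  map_mem w h := by
    rw [← Module.End.mul_apply, ← map_mul, hΛ.mul_left, map_smul, LinearMap.smul_apply]
  map_id w hw := by rw [hw Λ, hΛ.counit_eq_one, one_smul]

/-- The trace of the restriction of `A` to an invariant subspace is the trace of `A` composed with
a projection to the subspace. -/
theorem trace_restrict_eq_trace_mul {W : Type*} [AddCommGroup W] [Module k W]
    [FiniteDimensional k W] {p : Submodule k W} {P A : Module.End k W}
    (hP : LinearMap.IsProj p P) (hA : ∀ w ∈ p, A w ∈ p) :
    LinearMap.trace k p (A.restrict hA) = LinearMap.trace k W (A * P) := by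
  have h1 : A.restrict hA = hP.codRestrict ∘ₗ (A ∘ₗ p.subtype) := by
    ext w
    exact (hP.map_id _ (hA w w.2)).symm
  rw [h1, LinearMap.trace_comp_comm']
  rfl

/-- Taking the iterated comultiplication of the integral for `x` gives the twisted indicator on the
right-hand side. -/
theorem trace_cyclicShift_mul_twistedAction [FiniteDimensional k V] (ρ : H →ₐ[k] Module.End k V)
    (τ : H →ₐc[k] H) (n : ℕ) (x : ⨂[k] _ : Fin (n + 1), H) :
    LinearMap.trace k _ (cyclicShift k V (n + 1) * twistedAction ρ τ (n + 1) x) =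
      character ρ (PiTensorProduct.lift
        ((MultilinearMap.mkPiAlgebraFin k (n + 1) H).compLinearMap
          (fun i : Fin (n + 1) => ((τ ^ (i : ℕ) : H →ₐc[k] H) : H →ₐ[k] H).toLinearMap)) x) := by
  induction x using PiTensorProduct.induction_on with
  | smul_tprod r x =>
    simp only [map_smul, mul_smul_comm, twistedAction_tprod, trace_cyclicShift_mul_map,
      PiTensorProduct.lift.tprod, MultilinearMap.compLinearMap_apply,
      MultilinearMap.mkPiAlgebraFin_apply]
    congr 1
    simp only [character, LinearMap.comp_apply, AlgHom.toLinearMap_apply, map_list_prod,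
      List.map_ofFn]
    rfl
  | add x y hx hy => simp only [map_add, mul_add, hx, hy]

end Invariants

end TwistedFS

end

theorem theorem3p4 {k H V : Type*} [Field k] [IsAlgClosed k] [CharZero k]
    [Ring H] [HopfAlgebra k H] [IsSemisimpleRing H]
    (m : ℕ) (hm : 0 < m) (τ : H ≃ₐc[k] H) (hτ : (τ : H →ₐc[k] H) ^ m = 1)
    [AddCommGroup V] [Module k V] [FiniteDimensional k V] (ρ : H →ₐ[k] Module.End k V) :
    ∃ hα : ∀ w ∈ TwistedFS.invariants (TwistedFS.twistedTensorPower ρ (τ : H →ₐc[k] H) m),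
        TwistedFS.cyclicShift k V m w ∈
          TwistedFS.invariants (TwistedFS.twistedTensorPower ρ (τ : H →ₐc[k] H) m),
      TwistedFS.twistedIndicator m (TwistedFS.character ρ) (τ : H →ₐc[k] H) =
        LinearMap.trace k _ ((TwistedFS.cyclicShift k V m).restrict hα) := by
  obtain ⟨n, rfl⟩ : ∃ n, m = n + 1 := ⟨m - 1, by omega⟩
  have hΛ := TwistedFS.isNormalizedIntegral_integral k (H := H)
  have hα := fun w (hw : w ∈ TwistedFS.invariants
      (TwistedFS.twistedTensorPower ρ (τ : H →ₐc[k] H) (n + 1))) =>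
    TwistedFS.cyclicShift_mem_invariants hΛ.antipode_antipode ρ τ n hτ hw
  refine ⟨hα, ?_⟩
  rw [TwistedFS.trace_restrict_eq_trace_mul (TwistedFS.isProj_invariants _ hΛ) hα]
  exact (TwistedFS.trace_cyclicShift_mul_twistedAction ρ (τ : H →ₐc[k] H) n _).symm
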